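/- Let $d\ge 1$ and let $P(X)=X^d+a_{d-1}X^{d-1}+\cdots+a_0\in\mathbb Z[X]$ be a monic polynomial without multiple roots (for instance an irreducible one), with complex roots $\alpha_1,\dots,\alpha_d$. For $x\in\mathbb R$ let $\|x\|$ denote the distance from $x$ to the nearest integer. Let $\mathcal L(P)$ be the set of all values $$\limsup_{n\to\infty}\|x_n\|,\qquad x_n=\sum_{i:\,|\alpha_i|>1} g_i\,\alpha_i^n ,$$ where the coefficients $g_i\in\mathbb C$ run over all families such that $g_i\in\mathbb R$ if $\alpha_i\in\mathbb R$, and $g_j=\overline{g_i}$ if $\alpha_j=\overline{\alpha_i}$ (so that $x_n\in\mathbb R$). Put $$E(X)=\frac{1-(1-X)\prod_{m=0}^{\infty}(1-X^{2^m})}{2X},\qquad E^{(k)}(X)=\frac{1+X^{2^k}-(1-X)\prod_{m=0}^{k-1}(1-X^{2^m})}{2X(1+X^{2^k})}\quad(k\ge 0),$$ where the empty product is $1$, and $$E_d(X_1,\dots,X_d)=\sum_{i=1}^d\Bigl(\prod_{j\ne i}\frac{X_i}{X_i-X_j}\Bigr)E(X_i),\qquad E_d^{(k)}(X_1,\dots,X_d)=\sum_{i=1}^d\Bigl(\prod_{j\ne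 i}\frac{X_i}{X_i-X_j}\Bigr)E^{(k)}(X_i).$$ Assume that every $\alpha_j$ is real with $\alpha_j>1$, and that $\alpha_1^{-1}+\cdots+\alpha_d^{-1}\le \tfrac12$. Then $e:=|a_0|^{-1}E_d(\alpha_1^{-1},\dots,\alpha_d^{-1})$ is the minimal limit point (accumulation point) of $\mathcal L(P)$, and $$\mathcal L(P)\cap(0,e)=\Bigl\{\,|a_0|^{-1}E_d^{(k)}(\alpha_1^{-1},\dots,\alpha_d^{-1})\ :\ k=0,1,2,\dots\Bigr\}.$$ -/

import Mathlib

open Polynomial Filter Topology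
open scoped BigOperators ComplexConjugate

noncomputable section

namespace MarkoffLagrange

/-- Distance `‖x‖` from a real number to the nearest integer. -/
def distInt (x : ℝ) : ℝ := |x - round x|

/-- The expanding roots of `P`: its distinct complex roots of modulus greater than `1`. -/
def expandingRoots (P : ℤ[X]) : Finset ℂ :=
  (P.aroots ℂ).toFinset.filter fun z => 1 < ‖z‖

/-- The coefficient families `Ξ_k`: to every expanding root `z` a polynomial `g z` of degree at
most `k` is attached, and conjugate roots carry conjugate polynomials. (For a real root `z` the
second condition says that `g z` has real coefficients. The values of `g` away from the
expanding roots are irrelevant.) -/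
def coeffFamilies (k : ℕ) (P : ℤ[X]) : Set (ℂ → ℂ[X]) :=
  {g | ∀ z ∈ expandingRoots P,
    (g z).natDegree ≤ k ∧ g (conj z) = (g z).map (starRingEnd ℂ)}

/-- The linear recurrence `x_n(g) = ∑ g_i(n) α_i ^ n`, summed over the expanding roots `α_i`.
The sum is a real number for `g` in `Ξ_k`, which is why taking the real part loses nothing. -/
def recurrence (P : ℤ[X]) (g : ℂ → ℂ[X]) (n : ℤ) : ℝ :=
  (∑ z ∈ expandingRoots P, (g z).eval (n : ℂ) * z ^ n).re

/-- The set `L^(k)(P)` of all `limsup_{n → ∞} ‖x_n(g)‖` with `g` in `Ξ_k`. -/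
def spectrumOrder (k : ℕ) (P : ℤ[X]) : Set ℝ :=
  {x | ∃ g ∈ coeffFamilies k P,
    x = limsup (fun n : ℕ => distInt (recurrence P g (n : ℤ))) atTop}

/-- The spectrum `L(P) = L^(0)(P)`. -/
def spectrum (P : ℤ[X]) : Set ℝ := spectrumOrder 0 P

/-- `E(X) = (1 - (1 - X) ∏_{m ≥ 0} (1 - X^(2^m))) / (2X)`. -/
def E (x : ℝ) : ℝ := (1 - (1 - x) * ∏' m : ℕ, (1 - x ^ 2 ^ m)) / (2 * x)

/-- `E^(k)(X) = (1 + X^(2^k) - (1 - X) ∏_{0 ≤ m < k} (1 - X^(2^m))) / (2X (1 + X^(2^k)))`. -/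
def Efin (k : ℕ) (x : ℝ) : ℝ :=
  (1 + x ^ 2 ^ k - (1 - x) * ∏ m ∈ Finset.range k, (1 - x ^ 2 ^ m)) /
    (2 * x * (1 + x ^ 2 ^ k))

/-- `E_r(X_1, …, X_r) = ∑_i (∏_{j ≠ i} X_i / (X_i - X_j)) E(X_i)`. -/
def Emulti {r : ℕ} (x : Fin r → ℝ) : ℝ :=
  ∑ i, (∏ j ∈ Finset.univ.erase i, x i / (x i - x j)) * E (x i)

/-- `E_r^(k)(X_1, …, X_r) = ∑_i (∏_{j ≠ i} X_i / (X_i - X_j)) E^(k)(X_i)`. -/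
def EmultiFin (k : ℕ) {r : ℕ} (x : Fin r → ℝ) : ℝ :=
  ∑ i, (∏ j ∈ Finset.univ.erase i, x i / (x i - x j)) * Efin k (x i)

end MarkoffLagrange

end

/-! Let `S` be the shift on sequences, `β_i = 1/α_i`, and split `x_n = u_n + ε_n` with `u_n` the
nearest integer. The sequences `x` are exactly the solutions of `P(S) x = 0`, so `t = P(S) u = -P(S)
ε` is an integer sequence. On bounded sequences `P(S)` is inverted by a one-sided correlation with
the complete homogeneous symmetric polynomials `h_k(β)`, whence `|a_0| ‖x_n‖ = |∑ h_k t_{n+k}|`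
(`corr_pfKernel_aeval_nodal`).

The hypothesis `∑ β_i ≤ 1/2` acts twice. It gives `∏ (1 + α_i) ≤ 2 |a_0|`, so a value below `e`
forces `t_n ∈ {-1, 0, 1}` eventually. It also gives `h_{k+1} ≤ h_k / 2`, so two consecutive nonzero
`t_n` of equal sign would make the correlation at least 1; hence signs alternate and, unless `t` is
eventually zero, `t_n = b_n - b_{n+1}` for a binary sequence `b`. Summation by parts turns `|a_0|
‖x_n‖` into a weighted digit sum of `rel b n`, with weights `h_k - h_{k+1}` that respect the
lexicographic order.

What remains is combinatorial. If no `rel b n` eventually exceeds Thue–Morse, then `b` desubstitutes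
under `0 ↦ 01`, `1 ↦ 10` repeatedly (`exists_eq_dbl`): either this ends in a constant sequence, so
`b` has a tail `per k` up to complement, or arbitrarily long Thue–Morse prefixes recur and the
limsup is at least `|a_0| e`. Conversely each `per k` is realised by solving an integer recurrence,
and its digit sums converge strictly from below to that of Thue–Morse. Generating functions of
`(-1)^{e_n}` identify these sums with `E_d` and `E_d^{(k)}`. -/

namespace MarkoffLagrange

/-! ### Binary sequences and the Thue–Morse substitution -/

/-- The substitution `0 ↦ 01`, `1 ↦ 10` on binary sequences. -/
def dbl (c : ℕ → Bool) : ℕ → Bool := fun n => xor (c (n / 2)) (decide (n % 2 = 1))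

/-- The sequence `c` read from position `n` on, complemented if necessary so as to start
with `0`. -/
def rel (c : ℕ → Bool) (n : ℕ) : ℕ → Bool := fun k => xor (c n) (c (n + k))

/-- Strict lexicographic order on binary sequences. -/
def LexLt (e f : ℕ → Bool) : Prop := ∃ p, (∀ i < p, e i = f i) ∧ e p = false ∧ f p = true

/-- The periodic binary sequences `dbl^k (000…)`. -/
def per (k : ℕ) : ℕ → Bool := dbl^[k] fun _ => false

/-- The Thue–Morse sequence. -/
def thueMorse : ℕ → Bool
  | 0 => false
  | n + 1 => xor (thueMorse ((n + 1) / 2)) (decide ((n + 1) % 2 = 1))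
decreasing_by omega

theorem dbl_even (c : ℕ → Bool) (n : ℕ) : dbl c (2 * n) = c n := by
  simp [dbl]

theorem dbl_odd (c : ℕ → Bool) (n : ℕ) : dbl c (2 * n + 1) = !c n := by
  have h : (2 * n + 1) / 2 = n := by omega
  simp [dbl, h]

theorem dbl_ext {e f : ℕ → Bool} (h0 : ∀ n, e (2 * n) = f (2 * n))
    (h1 : ∀ n, e (2 * n + 1) = f (2 * n + 1)) : e = f := by
  funext n
  rcases Nat.even_or_odd' n with ⟨m, rfl | rfl⟩
  · exact h0 m
  · exact h1 m

theorem thueMorse_zero : thueMorse 0 = false := by rw [thueMorse]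

theorem dbl_thueMorse : dbl thueMorse = thueMorse := by
  funext n
  rcases n with _ | n
  · simp [dbl, thueMorse_zero]
  · rw [thueMorse]; rfl

theorem dbl_iterate_thueMorse (k : ℕ) : dbl^[k] thueMorse = thueMorse :=
  Function.iterate_fixed dbl_thueMorse k

theorem thueMorse_even (n : ℕ) : thueMorse (2 * n) = thueMorse n := by
  conv_lhs => rw [← dbl_thueMorse]
  exact dbl_even _ _

theorem thueMorse_odd (n : ℕ) : thueMorse (2 * n + 1) = !thueMorse n := by
  conv_lhs => rw [← dbl_thueMorse]
  exact dbl_odd _ _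

theorem thueMorse_one : thueMorse 1 = true := by
  simpa [thueMorse_zero] using thueMorse_odd 0

theorem thueMorse_two_pow (k : ℕ) : thueMorse (2 ^ k) = true := by
  induction k with
  | zero => exact thueMorse_one
  | succ k ih => rw [pow_succ', thueMorse_even, ih]

theorem rel_zero (c : ℕ → Bool) (n : ℕ) : rel c n 0 = false := by simp [rel]

theorem rel_dbl_even (c : ℕ → Bool) (n : ℕ) : rel (dbl c) (2 * n) = dbl (rel c n) := by
  refine dbl_ext (fun m => ?_) (fun m => ?_)
  · rw [dbl_even, rel, ← mul_add, dbl_even, dbl_even, rel]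
  · rw [dbl_odd, rel, ← add_assoc, ← mul_add, dbl_even, dbl_odd, rel]
    simp

theorem rel_dbl_iterate (k : ℕ) (c : ℕ → Bool) (n : ℕ) :
    rel (dbl^[k] c) (2 ^ k * n) = dbl^[k] (rel c n) := by
  induction k generalizing c n with
  | zero => simp
  | succ k ih =>
    rw [Function.iterate_succ_apply', Function.iterate_succ_apply', pow_succ', mul_assoc,
      rel_dbl_even, ih]

theorem dbl_iterate_shift (k : ℕ) (c : ℕ → Bool) (m i : ℕ) :
    dbl^[k] c (2 ^ k * m + i) = dbl^[k] (fun j => c (m + j)) i := by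
  induction k generalizing i with
  | zero => simp
  | succ k ih =>
    rw [Function.iterate_succ_apply', Function.iterate_succ_apply', pow_succ', mul_assoc]
    rcases Nat.even_or_odd' i with ⟨j, rfl | rfl⟩
    · rw [← mul_add, dbl_even, dbl_even, ih]
    · rw [← add_assoc, ← mul_add, dbl_odd, dbl_odd, ih]

theorem dbl_iterate_congr {e f : ℕ → Bool} {m : ℕ} (h : ∀ i < m, e i = f i) (k : ℕ) :
    ∀ i < 2 ^ k * m, dbl^[k] e i = dbl^[k] f i := by
  induction k with
  | zero => simpa using h
  | succ k ih =>
    intro i hi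
    rw [Function.iterate_succ_apply', Function.iterate_succ_apply']
    simp only [dbl]
    rw [ih (i / 2) (by rw [pow_succ', mul_assoc] at hi; omega)]

theorem LexLt.dbl {e f : ℕ → Bool} (h : LexLt e f) : LexLt (dbl e) (dbl f) := by
  obtain ⟨p, h1, h2, h3⟩ := h
  refine ⟨2 * p, fun i hi => ?_, by rw [dbl_even, h2], by rw [dbl_even, h3]⟩
  simp only [MarkoffLagrange.dbl]
  rw [h1 (i / 2) (by omega)]

theorem LexLt.iterate {e f : ℕ → Bool} (h : LexLt e f) (k : ℕ) :
    LexLt (MarkoffLagrange.dbl^[k] e) (MarkoffLagrange.dbl^[k] f) := by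
  induction k with
  | zero => exact h
  | succ k ih => rw [Function.iterate_succ_apply', Function.iterate_succ_apply']; exact ih.dbl

theorem dbl_iterate_xor (k : ℕ) (a : Bool) (c : ℕ → Bool) :
    dbl^[k] (fun n => xor a (c n)) = fun n => xor a (dbl^[k] c n) := by
  induction k with
  | zero => rfl
  | succ k ih =>
    funext n
    rw [Function.iterate_succ_apply', Function.iterate_succ_apply', ih]
    simp [dbl]

theorem per_succ (k : ℕ) : per (k + 1) = dbl (per k) := Function.iterate_succ_apply' _ _ _

theorem dbl_iterate_const (k : ℕ) (a : Bool) :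
    dbl^[k] (fun _ => a) = fun n => xor a (per k n) := by
  have := dbl_iterate_xor k a (fun _ => false)
  simp only [Bool.xor_false] at this
  exact this

theorem rel_xor (a : Bool) (c : ℕ → Bool) (n : ℕ) : rel (fun n => xor a (c n)) n = rel c n := by
  funext k; simp only [rel]; cases a <;> cases c n <;> cases c (n + k) <;> rfl

theorem per_zero_apply (k : ℕ) : per k 0 = false := by
  induction k with
  | zero => rfl
  | succ k ih => rw [per_succ]; exact (dbl_even (per k) 0).trans ih

theorem per_succ_one (k : ℕ) : per (k + 1) 1 = true := by
  rw [per_succ]; simpa [per_zero_apply] using dbl_odd (per k) 0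

theorem rel_per_two_pow_mul (k n : ℕ) : rel (per k) (2 ^ k * n) = per k := by
  rw [per, rel_dbl_iterate]; rfl

theorem per_two_pow (k : ℕ) : per k (2 ^ k) = false := by
  have h := dbl_iterate_shift k (fun _ => false) 1 0
  rw [mul_one, add_zero] at h
  exact h.trans (per_zero_apply k)

theorem per_eq_thueMorse (k : ℕ) : ∀ i < 2 ^ k, per k i = thueMorse i := by
  intro i hi
  rw [← dbl_iterate_thueMorse k]
  refine dbl_iterate_congr (m := 1) (fun i hi => ?_) k i (by simpa using hi)
  rw [Nat.lt_one_iff.mp hi, thueMorse_zero]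

/-! ### Lexicographic extremality and desubstitution -/

/-- For `0101…` all relative tails coincide. After a further doubling the sequence begins `011`;
tails at even positions are doubled tails, while those at odd positions begin `00` or `010` and so
are smaller. -/
theorem rel_per_succ_le (k n : ℕ) :
    rel (per (k + 1)) n = per (k + 1) ∨ LexLt (rel (per (k + 1)) n) (per (k + 1)) := by
  induction k generalizing n with
  | zero =>
    left
    rcases Nat.even_or_odd' n with ⟨m, rfl | rfl⟩
    · simpa using rel_per_two_pow_mul 1 m
    · refine dbl_ext (fun j => ?_) (fun j => ?_)
      · have h : 2 * m + 1 + 2 * j = 2 * (m + j) + 1 := by ring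
        rw [rel, h, per_succ, dbl_odd, dbl_odd, dbl_even]; rfl
      · have h : 2 * m + 1 + (2 * j + 1) = 2 * (m + j + 1) := by ring
        rw [rel, h, per_succ, dbl_odd, dbl_odd, dbl_even]; rfl
  | succ k ih =>
    rw [per_succ (k + 1)]
    set c := per (k + 1) with hc
    have c0 : c 0 = false := per_zero_apply _
    have c1 : c 1 = true := per_succ_one _
    rcases Nat.even_or_odd' n with ⟨m, rfl | rfl⟩
    · rw [rel_dbl_even]
      rcases ih m with h | h
      · left; rw [h]
      · right; exact h.dbl
    · right
      have d0 : dbl c 0 = false := (dbl_even c 0).trans c0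
      have d1 : dbl c 1 = true := by simpa [c0] using dbl_odd c 0
      have d2 : dbl c 2 = true := (dbl_even c 1).trans c1
      have r1 : rel (dbl c) (2 * m + 1) 1 = xor (!c m) (c (m + 1)) := by
        have h : 2 * m + 1 + 1 = 2 * (m + 1) := by ring
        rw [rel, h, dbl_odd, dbl_even]
      have r2 : rel (dbl c) (2 * m + 1) 2 = xor (!c m) (!c (m + 1)) := by
        have h : 2 * m + 1 + 2 = 2 * (m + 1) + 1 := by ring
        rw [rel, h, dbl_odd, dbl_odd]
      by_cases hcm : c m = c (m + 1)
      · refine ⟨2, fun i hi => ?_, ?_, d2⟩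
        · interval_cases i
          · rw [rel_zero, d0]
          · rw [r1, d1, hcm]; simp
        · rw [r2, hcm]; simp
      · refine ⟨1, fun i hi => ?_, ?_, d1⟩
        · rw [Nat.lt_one_iff.mp hi, rel_zero, d0]
        · rw [r1]; revert hcm; cases c m <;> cases c (m + 1) <;> simp

theorem exists_eq_dbl_of_forall_ne {c : ℕ → Bool} {m : ℕ}
    (h : ∀ i, c (m + 2 * i) ≠ c (m + 2 * i + 1)) :
    ∃ c' : ℕ → Bool, ∀ i, c (m + i) = dbl c' i := by
  refine ⟨fun i => c (m + 2 * i), fun i => ?_⟩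
  rcases Nat.even_or_odd' i with ⟨j, rfl | rfl⟩
  · rw [dbl_even]
  · rw [dbl_odd, ← add_assoc]
    have := h j
    revert this
    cases c (m + 2 * j) <;> cases c (m + 2 * j + 1) <;> simp

/-- A tail starting `011` that does not exceed `0110100…` must start `01100` or `0110100`. Either
way the next pair is again unequal and the situation recurs two or four places later, so cutting
into unequal pairs never fails. If no `011` occurs beyond `N`, a single change of digit forces
strict alternation. -/
theorem exists_eq_dbl {c : ℕ → Bool} {N : ℕ} (hc : ∀ n ≥ N, ¬LexLt thueMorse (rel c n))
    (hconst : ∀ M, ∃ n ≥ M, c n ≠ c (n + 1)) :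
    ∃ (M : ℕ) (c' : ℕ → Bool), ∀ i, c (M + i) = dbl c' i := by
  have t0 : thueMorse 0 = false := thueMorse_zero
  have t1 : thueMorse 1 = true := thueMorse_one
  have t2 : thueMorse 2 = true := thueMorse_two_pow 1
  have t3 : thueMorse 3 = false := by simpa [t1] using thueMorse_odd 1
  have t4 : thueMorse 4 = true := thueMorse_two_pow 2
  have t5 : thueMorse 5 = false := by simpa [t2] using thueMorse_odd 2
  have t6 : thueMorse 6 = false := by simpa [t3] using thueMorse_even 3
  have key : ∀ m ≥ N, c m ≠ c (m + 1) → c (m + 1) = c (m + 2) →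
      c (m + 2) ≠ c (m + 3) ∧ (c (m + 3) = c (m + 4) ∨
        (c (m + 4) ≠ c (m + 5) ∧ c (m + 5) = c (m + 6))) := by
    intro m hm h1 h2
    by_contra hcon
    have aux : ∀ {x y : Bool}, x ≠ y → y = !x := by decide
    have v1 : c (m + 1) = !c m := aux h1
    have v2 : c (m + 2) = !c m := h2.symm.trans v1
    apply hc m hm
    by_cases h3 : c (m + 2) = c (m + 3)
    · have v3 : c (m + 3) = !c m := h3.symm.trans v2
      exact ⟨3, fun i hi => by interval_cases i <;> simp [rel, t0, t1, t2, v1, v2], t3,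
        by simp [rel, v3]⟩
    have v3 : c (m + 3) = c m := by simpa [v2] using aux h3
    by_cases h4 : c (m + 3) = c (m + 4)
    · exact absurd ⟨h3, Or.inl h4⟩ hcon
    have v4 : c (m + 4) = !c m := by simpa [v3] using aux h4
    by_cases h5 : c (m + 4) = c (m + 5)
    · have v5 : c (m + 5) = !c m := h5.symm.trans v4
      exact ⟨5, fun i hi => by
        interval_cases i <;> simp [rel, t0, t1, t2, t3, t4, v1, v2, v3, v4], t5, by simp [rel, v5]⟩
    have v5 : c (m + 5) = c m := by simpa [v4] using aux h5
    by_cases h6 : c (m + 5) = c (m + 6)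
    · exact absurd ⟨h3, Or.inr ⟨h5, h6⟩⟩ hcon
    have v6 : c (m + 6) = !c m := by simpa [v5] using aux h6
    exact ⟨6, fun i hi => by
      interval_cases i <;> simp [rel, t0, t1, t2, t3, t4, t5, v1, v2, v3, v4, v5], t6,
      by simp [rel, v6]⟩
  by_cases hS : ∃ m ≥ N, c m ≠ c (m + 1) ∧ c (m + 1) = c (m + 2)
  · obtain ⟨m, hm, h1, h2⟩ := hS
    refine ⟨m, exists_eq_dbl_of_forall_ne ?_⟩
    -- Invariant at a pair boundary: the pair is unequal, and a repeated digit straddles the next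
    -- boundary or the one after it.
    have : ∀ i, c (m + 2 * i) ≠ c (m + 2 * i + 1) ∧ (c (m + 2 * i + 1) = c (m + 2 * i + 2) ∨
        c (m + 2 * i + 2) ≠ c (m + 2 * i + 3) ∧ c (m + 2 * i + 3) = c (m + 2 * i + 4)) := by
      intro i
      induction i with
      | zero => exact ⟨h1, Or.inl h2⟩
      | succ i ih =>
        have e : m + 2 * (i + 1) = m + 2 * i + 2 := by ring
        rw [e]
        rcases ih with ⟨ih1, ih2 | ⟨ih2, ih3⟩⟩
        · exact key _ (by omega) ih1 ih2
        · exact ⟨ih2, Or.inl ih3⟩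
    exact fun i => (this i).1
  · push Not at hS
    obtain ⟨m, hm, h1⟩ := hconst N
    refine ⟨m, exists_eq_dbl_of_forall_ne ?_⟩
    have : ∀ i, c (m + i) ≠ c (m + i + 1) := by
      intro i
      induction i with
      | zero => exact h1
      | succ i ih => exact hS (m + i) (by omega) ih
    exact fun i => this (2 * i)

/-- Thue–Morse is fixed by `dbl` and `dbl` preserves the strict order, so the bound passes to each
desubstituted sequence. If no level is eventually constant, changes of digit recur at level `k`, and
`dbl^[k]` of a tail `01…` is a Thue–Morse prefix of length `2 ^ (k + 1)`. -/
theorem eventually_dbl_iterate_const_or {b : ℕ → Bool} {N : ℕ}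
    (hb : ∀ n ≥ N, ¬LexLt thueMorse (rel b n)) :
    (∃ (k M : ℕ) (a : Bool), ∀ i, b (M + i) = dbl^[k] (fun _ => a) i) ∨
      ∀ k, ∃ᶠ n in atTop, ∀ i < 2 ^ (k + 1), rel b n i = thueMorse i := by
  rw [or_iff_not_imp_left]
  intro hcon
  have rel_eq : ∀ {k M : ℕ} {c : ℕ → Bool}, (∀ i, b (M + i) = dbl^[k] c i) → ∀ n,
      rel b (M + 2 ^ k * n) = dbl^[k] (rel c n) := by
    intro k M c h n
    rw [← rel_dbl_iterate]
    funext i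
    simp only [rel, ← h, add_assoc]
  have nonconst : ∀ {k M : ℕ} {c : ℕ → Bool}, (∀ i, b (M + i) = dbl^[k] c i) →
      ∀ m, ∃ n ≥ m, c n ≠ c (n + 1) := by
    intro k M c h m
    by_contra hm
    push Not at hm
    refine hcon ⟨k, M + 2 ^ k * m, c m, fun i => ?_⟩
    rw [add_assoc, h, dbl_iterate_shift]
    refine congrFun (congrArg _ (funext fun j => ?_)) i
    induction j with
    | zero => rfl
    | succ j ih => rw [← ih, ← add_assoc, hm (m + j) (by omega)]
  have large : ∀ k M n : ℕ, n ≤ M + 2 ^ k * n := fun k M n =>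
    (Nat.le_mul_of_pos_left n (by positivity)).trans (Nat.le_add_left _ _)
  have desc : ∀ k, ∃ (M : ℕ) (c : ℕ → Bool), ∀ i, b (M + i) = dbl^[k] c i := by
    intro k
    induction k with
    | zero => exact ⟨0, b, fun i => by simp⟩
    | succ k ih =>
      obtain ⟨M, c, h⟩ := ih
      obtain ⟨M', c', h'⟩ := exists_eq_dbl (c := c) (N := N) (fun n hn hlt => by
        have := LexLt.iterate hlt k
        rw [dbl_iterate_thueMorse, ← rel_eq h] at this
        exact hb _ (hn.le.trans (large k M n)) this) (nonconst h)
      refine ⟨M + 2 ^ k * M', c', fun i => ?_⟩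
      rw [add_assoc, h, dbl_iterate_shift, Function.iterate_succ_apply]
      exact congrFun (congrArg _ (funext h')) i
  intro k
  obtain ⟨M, c, h⟩ := desc k
  rw [frequently_atTop]
  intro m
  obtain ⟨n, hn, hne⟩ := nonconst h m
  refine ⟨M + 2 ^ k * n, hn.le.trans (large k M n), ?_⟩
  rw [rel_eq h, ← dbl_iterate_thueMorse k, pow_succ]
  refine dbl_iterate_congr (fun i hi => ?_) k
  interval_cases i
  · rw [rel_zero, thueMorse_zero]
  · rw [thueMorse_one, rel]
    revert hne
    cases c n <;> cases c (n + 1) <;> simp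

/-! ### Weighted digit sums and the lexicographic order -/

/-- The numerical value of a binary digit. -/
def bit (a : Bool) : ℝ := if a then 1 else 0

/-- Positive summable weights for which the weighted sum of binary digits is monotone with
respect to the lexicographic order. -/
structure IsWeight (q : ℕ → ℝ) : Prop where
  pos : ∀ k, 0 < q k
  summable : Summable q
  tail_le : ∀ k, ∑' j, q (j + (k + 1)) ≤ q k

/-- The weighted sum of the digits of `e` from position `1` on. -/
noncomputable def wsum (q : ℕ → ℝ) (e : ℕ → Bool) : ℝ := ∑' k, q k * bit (e (k + 1))

theorem bit_nonneg (a : Bool) : 0 ≤ bit a := by unfold bit; split_ifs <;> norm_num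

theorem bit_le_one (a : Bool) : bit a ≤ 1 := by unfold bit; split_ifs <;> norm_num

theorem bit_not (a : Bool) : bit (!a) = 1 - bit a := by cases a <;> simp [bit]

variable {q : ℕ → ℝ}

theorem IsWeight.summable_bit (hq : IsWeight q) (e : ℕ → Bool) :
    Summable fun k => q k * bit (e (k + 1)) :=
  hq.summable.of_nonneg_of_le (fun k => mul_nonneg (hq.pos k).le (bit_nonneg _))
    fun k => mul_le_of_le_one_right (hq.pos k).le (bit_le_one _)

theorem IsWeight.summable_add (hq : IsWeight q) (m : ℕ) : Summable fun j => q (j + m) :=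
  (summable_nat_add_iff m).2 hq.summable

theorem IsWeight.wsum_nonneg (hq : IsWeight q) (e : ℕ → Bool) : 0 ≤ wsum q e :=
  tsum_nonneg fun k => mul_nonneg (hq.pos k).le (bit_nonneg _)

theorem IsWeight.wsum_le (hq : IsWeight q) (e : ℕ → Bool) : wsum q e ≤ ∑' k, q k :=
  (hq.summable_bit e).tsum_le_tsum
    (fun k => mul_le_of_le_one_right (hq.pos k).le (bit_le_one _)) hq.summable

theorem IsWeight.wsum_sub (hq : IsWeight q) {e f : ℕ → Bool} {m : ℕ}
    (h : ∀ i < m + 1, e i = f i) :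
    wsum q f - wsum q e =
      ∑' j, q (j + m) * (bit (f (j + m + 1)) - bit (e (j + m + 1))) := by
  have hs := (hq.summable_bit f).sub (hq.summable_bit e)
  rw [wsum, wsum, ← (hq.summable_bit f).tsum_sub (hq.summable_bit e), ← hs.sum_add_tsum_nat_add m,
    Finset.sum_eq_zero, zero_add]
  · exact tsum_congr fun j => by ring
  · intro i hi
    rw [h (i + 1) (by simpa using hi), sub_self]

theorem IsWeight.summable_sub (hq : IsWeight q) (e f : ℕ → Bool) (m : ℕ) :
    Summable fun j => q (j + m) * (bit (f (j + m + 1)) - bit (e (j + m + 1))) := by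
  refine ((summable_nat_add_iff m).2 ((hq.summable_bit f).sub (hq.summable_bit e))).congr
    fun j => ?_
  ring

theorem neg_one_le_bit_sub (a b : Bool) : -1 ≤ bit a - bit b := by
  linarith [bit_nonneg a, bit_le_one b]

theorem bit_sub_le_one (a b : Bool) : bit a - bit b ≤ 1 := by
  linarith [bit_nonneg b, bit_le_one a]

theorem IsWeight.wsum_sub_of_first (hq : IsWeight q) {e f : ℕ → Bool} {m : ℕ}
    (h : ∀ i < m + 1, e i = f i) (he : e (m + 1) = false) (hf : f (m + 1) = true) :
    wsum q f - wsum q e = q m + ∑' j, q (j + (m + 1)) *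
      (bit (f (j + (m + 1) + 1)) - bit (e (j + (m + 1) + 1))) := by
  rw [hq.wsum_sub h, (hq.summable_sub e f m).tsum_eq_zero_add]
  congr 1
  · simp [he, hf, bit]
  · refine tsum_congr fun j => ?_
    rw [show j + 1 + m = j + (m + 1) by ring]

theorem IsWeight.neg_le_tail (hq : IsWeight q) (e f : ℕ → Bool) (m : ℕ) :
    -q m ≤ ∑' j, q (j + (m + 1)) * (bit (f (j + (m + 1) + 1)) - bit (e (j + (m + 1) + 1))) := by
  refine (neg_le_neg (hq.tail_le m)).trans ?_
  rw [← tsum_neg]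
  refine (hq.summable_add (m + 1)).neg.tsum_le_tsum (fun j => ?_) (hq.summable_sub e f (m + 1))
  nlinarith [hq.pos (j + (m + 1)), neg_one_le_bit_sub (f (j + (m + 1) + 1)) (e (j + (m + 1) + 1))]

theorem IsWeight.wsum_le_of_lexLt (hq : IsWeight q) {e f : ℕ → Bool} (h : LexLt e f)
    (hf0 : f 0 = false) : wsum q e ≤ wsum q f := by
  obtain ⟨_ | m, h1, h2, h3⟩ := h
  -- Digit 0 carries no weight; since `f 0 = false`, the first difference lies at a weighted
  -- position.
  · simp [hf0] at h3
  · have := hq.wsum_sub_of_first h1 h2 h3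
    have := hq.neg_le_tail e f m
    linarith

/-- The tail can cancel the gain `q m` only if all later digits of `f` are 0; one later 1 therefore
makes the comparison strict even when `tail_le` is an equality. -/
theorem IsWeight.wsum_lt (hq : IsWeight q) {e f : ℕ → Bool} {m : ℕ}
    (h : ∀ i < m + 1, e i = f i) (he : e (m + 1) = false) (hf : f (m + 1) = true)
    (hj : ∃ j > m + 1, f j = true) : wsum q e < wsum q f := by
  have h1 := hq.wsum_sub_of_first h he hf
  have h2 : -q m < ∑' j, q (j + (m + 1)) *
      (bit (f (j + (m + 1) + 1)) - bit (e (j + (m + 1) + 1))) := by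
    refine (neg_le_neg (hq.tail_le m)).trans_lt ?_
    rw [← tsum_neg]
    obtain ⟨j, hj, hfj⟩ := hj
    obtain ⟨i, rfl⟩ := Nat.exists_eq_add_of_lt hj
    refine Summable.tsum_lt_tsum (i := i) (fun j => ?_) ?_ (hq.summable_add (m + 1)).neg
      (hq.summable_sub e f (m + 1))
    · nlinarith [hq.pos (j + (m + 1)),
        neg_one_le_bit_sub (f (j + (m + 1) + 1)) (e (j + (m + 1) + 1))]
    · rw [show m + 1 + i + 1 = i + (m + 1) + 1 by ring] at hfj
      rw [hfj]
      have : bit true = 1 := rfl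
      nlinarith [hq.pos (i + (m + 1)), bit_le_one (e (i + (m + 1) + 1))]
  linarith

theorem IsWeight.wsum_per_lt (hq : IsWeight q) (k : ℕ) : wsum q (per k) < wsum q thueMorse := by
  obtain ⟨m, hm⟩ : ∃ m, 2 ^ k = m + 1 := ⟨2 ^ k - 1, by have := Nat.two_pow_pos k; omega⟩
  refine hq.wsum_lt (m := m) ?_ ?_ ?_ ⟨2 ^ (k + 1), ?_, thueMorse_two_pow _⟩
  · rw [← hm]; exact per_eq_thueMorse k
  · rw [← hm]; exact per_two_pow k
  · rw [← hm]; exact thueMorse_two_pow k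
  · rw [← hm, pow_succ]; have := Nat.two_pow_pos k; omega

theorem IsWeight.wsum_per_succ_pos (hq : IsWeight q) (k : ℕ) : 0 < wsum q (per (k + 1)) :=
  (hq.summable_bit _).tsum_pos (fun j => mul_nonneg (hq.pos j).le (bit_nonneg _)) 0
    (by simp [per_succ_one, bit, hq.pos 0])

theorem IsWeight.abs_wsum_sub_le (hq : IsWeight q) {e f : ℕ → Bool} {m : ℕ}
    (h : ∀ i < m + 1, e i = f i) : |wsum q f - wsum q e| ≤ ∑' j, q (j + m) := by
  rw [hq.wsum_sub h, abs_le, ← tsum_neg]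
  constructor
  · refine (hq.summable_add m).neg.tsum_le_tsum (fun j => ?_) (hq.summable_sub e f m)
    nlinarith [hq.pos (j + m), neg_one_le_bit_sub (f (j + m + 1)) (e (j + m + 1))]
  · refine (hq.summable_sub e f m).tsum_le_tsum (fun j => ?_) (hq.summable_add m)
    nlinarith [hq.pos (j + m), bit_sub_le_one (f (j + m + 1)) (e (j + m + 1))]

theorem tendsto_two_pow_sub_one : Tendsto (fun k : ℕ => 2 ^ k - 1) atTop atTop :=
  tendsto_atTop_mono (fun _ => Nat.le_sub_one_of_lt Nat.lt_two_pow_self) tendsto_id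

theorem IsWeight.tendsto_wsum (hq : IsWeight q) {e : ℕ → ℕ → Bool} {f : ℕ → Bool}
    (h : ∀ k, ∀ i < 2 ^ k, e k i = f i) :
    Tendsto (fun k => wsum q (e k)) atTop (𝓝 (wsum q f)) := by
  rw [tendsto_iff_dist_tendsto_zero]
  refine squeeze_zero (fun _ => dist_nonneg) (fun k => ?_)
    ((tendsto_sum_nat_add q).comp tendsto_two_pow_sub_one)
  rw [dist_comm, Real.dist_eq]
  refine hq.abs_wsum_sub_le fun i hi => h k i ?_
  rwa [Nat.sub_add_cancel Nat.one_le_two_pow] at hi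

theorem IsWeight.tendsto_wsum_per (hq : IsWeight q) :
    Tendsto (fun k => wsum q (per k)) atTop (𝓝 (wsum q thueMorse)) :=
  hq.tendsto_wsum per_eq_thueMorse

/-! ### Limsups of the digit sums of relative tails -/

theorem limsup_eq_of_eventually_le_of_frequently_eq {u : ℕ → ℝ} {a : ℝ}
    (h1 : ∀ᶠ n in atTop, u n ≤ a) (h2 : ∃ᶠ n in atTop, u n = a) : limsup u atTop = a := by
  have h3 : ∃ᶠ n in atTop, a ≤ u n := h2.mono fun n h => h.ge
  exact le_antisymm (limsup_le_of_le (IsCoboundedUnder.of_frequently_ge h3) h1)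
    (le_limsup_of_frequently_le h3 (isBoundedUnder_of_eventually_le h1))

theorem IsWeight.isBoundedUnder_wsum (hq : IsWeight q) (e : ℕ → ℕ → Bool) :
    IsBoundedUnder (· ≤ ·) atTop fun n => wsum q (e n) :=
  isBoundedUnder_of ⟨_, fun n => hq.wsum_le (e n)⟩

theorem IsWeight.limsup_rel_per (hq : IsWeight q) {b : ℕ → Bool} {k M : ℕ} {a : Bool}
    (h : ∀ i, b (M + i) = dbl^[k] (fun _ => a) i) :
    limsup (fun n => wsum q (rel b n)) atTop = wsum q (per k) := by
  have hrel : ∀ n, rel b (M + n) = rel (per k) n := by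
    intro n
    rw [← rel_xor a (per k) n, ← dbl_iterate_const]
    funext i
    simp only [rel, ← h, add_assoc]
  have hle : ∀ n, wsum q (rel (per k) n) ≤ wsum q (per k) := by
    rcases k with _ | k
    · intro n
      rw [show rel (per 0) n = per 0 from rfl]
    · intro n
      rcases rel_per_succ_le k n with h | h
      · rw [h]
      · exact hq.wsum_le_of_lexLt h (per_zero_apply _)
  refine limsup_eq_of_eventually_le_of_frequently_eq ?_ ?_
  · filter_upwards [eventually_ge_atTop M] with n hn
    obtain ⟨i, rfl⟩ := Nat.exists_eq_add_of_le hn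
    rw [hrel]
    exact hle i
  · rw [frequently_atTop]
    refine fun n => ⟨M + 2 ^ k * n, ?_, by rw [hrel, rel_per_two_pow_mul]⟩
    exact (Nat.le_mul_of_pos_left n (by positivity)).trans (Nat.le_add_left _ _)

theorem IsWeight.wsum_per_zero : wsum q (per 0) = 0 := by
  simp [wsum, per, bit]

theorem IsWeight.limsup_rel_eq (hq : IsWeight q) {b : ℕ → Bool}
    (h : limsup (fun n => wsum q (rel b n)) atTop < wsum q thueMorse) :
    ∃ k, limsup (fun n => wsum q (rel b n)) atTop = wsum q (per k) := by
  obtain ⟨N, hN⟩ := eventually_atTop.1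
    (eventually_lt_of_limsup_lt h (hq.isBoundedUnder_wsum (rel b)))
  rcases eventually_dbl_iterate_const_or (b := b) (N := N) (fun n hn hlt =>
    (hN n hn).not_ge (hq.wsum_le_of_lexLt hlt (rel_zero b n))) with ⟨k, M, a, hk⟩ | hall
  · exact ⟨k, hq.limsup_rel_per hk⟩
  · refine absurd h (not_lt.2 (le_of_forall_pos_le_add fun ε hε => ?_))
    obtain ⟨k, hk⟩ := (((tendsto_sum_nat_add q).comp
      (tendsto_two_pow_sub_one.comp (tendsto_add_atTop_nat 1))).eventually (gt_mem_nhds hε)).exists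
    rw [← sub_le_iff_le_add]
    refine le_limsup_of_frequently_le ((hall k).mono fun n hn => ?_)
      (hq.isBoundedUnder_wsum (rel b))
    have := (abs_le.1 (hq.abs_wsum_sub_le (m := 2 ^ (k + 1) - 1) (fun i hi => hn i
      (by rwa [Nat.sub_add_cancel Nat.one_le_two_pow] at hi)))).2
    simp only [Function.comp_apply] at hk
    linarith

/-! ### Kernels and alternation of signs -/

/-- Positive kernels decreasing at least as fast as `2 ^ (-k)`. -/
structure IsKernel (h : ℕ → ℝ) : Prop where
  zero : h 0 = 1
  pos : ∀ k, 0 < h k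
  succ_le : ∀ k, h (k + 1) ≤ h k / 2

/-- The one-sided correlation of a kernel with a sequence. -/
noncomputable def corr (h : ℕ → ℝ) (y : ℕ → ℝ) (n : ℕ) : ℝ := ∑' k, h k * y (n + k)

/-- The weights obtained from a kernel by partial summation. -/
def weight (h : ℕ → ℝ) (k : ℕ) : ℝ := h k - h (k + 1)

variable {h : ℕ → ℝ}

theorem IsKernel.le_geometric (hh : IsKernel h) (m j : ℕ) :
    h (j + (m + 1)) ≤ h m / 2 / 2 ^ j := by
  induction j with
  | zero => simpa using hh.succ_le m
  | succ j ih =>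
    rw [show j + 1 + (m + 1) = j + (m + 1) + 1 by ring]
    refine (hh.succ_le _).trans ?_
    rw [pow_succ, ← div_div]
    gcongr

theorem IsKernel.summable (hh : IsKernel h) : Summable h :=
  (summable_nat_add_iff 1).1 ((summable_geometric_two' (h 0)).of_nonneg_of_le
    (fun _ => (hh.pos _).le) (hh.le_geometric 0))

theorem IsKernel.summable_add (hh : IsKernel h) (m : ℕ) : Summable fun j => h (j + m) :=
  (summable_nat_add_iff m).2 hh.summable

theorem IsKernel.tail_le (hh : IsKernel h) (m : ℕ) : ∑' j, h (j + (m + 1)) ≤ h m := by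
  rw [← tsum_geometric_two' (h m)]
  exact (hh.summable_add _).tsum_le_tsum (hh.le_geometric m) (summable_geometric_two' (h m))

theorem IsKernel.tsum_weight (hh : IsKernel h) (m : ℕ) : ∑' j, weight h (j + m) = h m := by
  have h1 : ∀ j, weight h (j + m) = h (j + m) - h (j + (m + 1)) := fun j => by
    rw [weight, show j + m + 1 = j + (m + 1) by ring]
  simp_rw [h1]
  rw [(hh.summable_add m).tsum_sub (hh.summable_add (m + 1)), (hh.summable_add m).tsum_eq_zero_add,
    zero_add]
  have h2 : ∀ j, h (j + 1 + m) = h (j + (m + 1)) := fun j => by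
    rw [show j + 1 + m = j + (m + 1) by ring]
  simp_rw [h2]
  ring

theorem IsKernel.isWeight (hh : IsKernel h) : IsWeight (weight h) where
  pos k := by
    have := hh.succ_le k
    have := hh.pos k
    unfold weight
    linarith
  summable := hh.summable.sub (hh.summable_add 1)
  tail_le k := by
    rw [hh.tsum_weight, weight]
    have := hh.succ_le k
    linarith

theorem IsKernel.wsum_le_one (hh : IsKernel h) (e : ℕ → Bool) : wsum (weight h) e ≤ 1 := by
  rw [← hh.zero, ← hh.tsum_weight 0]
  exact hh.isWeight.wsum_le e

theorem IsKernel.summable_mul (hh : IsKernel h) {y : ℕ → ℝ} {C : ℝ} (hy : ∀ n, |y n| ≤ C) :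
    Summable fun k => h k * y k := by
  refine (hh.summable.mul_right C).of_norm_bounded fun k => ?_
  rw [Real.norm_eq_abs, abs_mul, abs_of_pos (hh.pos k)]
  exact mul_le_mul_of_nonneg_left (hy k) (hh.pos k).le

theorem abs_bit_le_one (a : Bool) : |bit a| ≤ 1 := by
  rw [abs_of_nonneg (bit_nonneg a)]; exact bit_le_one a

/-- Summation by parts; the boundary term is `h 0 * bit (e 0) = 0`. -/
theorem IsKernel.tsum_bit_sub (hh : IsKernel h) {e : ℕ → Bool} (he : e 0 = false) :
    ∑' k, h k * (bit (e (k + 1)) - bit (e k)) = wsum (weight h) e := by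
  have s1 := hh.summable_mul (y := fun k => bit (e (k + 1))) (fun k => abs_bit_le_one _)
  have s2 := hh.summable_mul (y := fun k => bit (e k)) (fun k => abs_bit_le_one _)
  have s3 := (summable_nat_add_iff 1).2 s2
  simp_rw [mul_sub]
  rw [s1.tsum_sub s2, s2.tsum_eq_zero_add, he, wsum]
  simp only [weight, sub_mul]
  rw [s1.tsum_sub s3]
  simp [bit]

theorem IsKernel.abs_corr_bit_sub (hh : IsKernel h) {b : ℕ → Bool} {y : ℕ → ℝ} {n : ℕ}
    (hy : ∀ m ≥ n, y m = bit (b m) - bit (b (m + 1))) :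
    |corr h y n| = wsum (weight h) (rel b n) := by
  have hw := hh.isWeight.wsum_nonneg (rel b n)
  have hy' : ∀ k, y (n + k) = bit (b (n + k)) - bit (b (n + (k + 1))) := fun k =>
    hy _ (Nat.le_add_right n k)
  rw [← hh.tsum_bit_sub (rel_zero b n)] at hw ⊢
  cases hb : b n
  · rw [← abs_of_nonneg hw, ← abs_neg, corr, ← tsum_neg]
    congr 1
    refine tsum_congr fun k => ?_
    simp only [hy', rel, hb, Bool.false_xor]
    ring
  · rw [← abs_of_nonneg hw, corr]
    congr 1
    refine tsum_congr fun k => ?_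
    simp only [hy', rel, hb, Bool.true_xor, bit_not]
    ring

/-- The terms at `0` and `r` contribute `1 + h r`, and everything beyond `r` takes away at most `h
r`. -/
theorem IsKernel.one_le_tsum (hh : IsKernel h) {y : ℕ → ℝ} {r : ℕ} (hy : ∀ k, |y k| ≤ 1)
    (hr : 0 < r) (h0 : y 0 = 1) (hmid : ∀ k, 0 < k → k < r → y k = 0) (hyr : y r = 1) :
    1 ≤ ∑' k, h k * y k := by
  have hs := hh.summable_mul hy
  rw [← hs.sum_add_tsum_nat_add (r + 1), Finset.sum_range_succ, hyr]
  have h1 : 1 ≤ ∑ k ∈ Finset.range r, h k * y k := by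
    have := Finset.single_le_sum (f := fun k => h k * y k) (s := Finset.range r) (a := 0)
      (fun k hk => ?_) (Finset.mem_range.2 hr)
    · simpa [hh.zero, h0] using this
    · rcases Nat.eq_zero_or_pos k with rfl | hk0
      · simp [hh.zero, h0]
      · simp [hmid k hk0 (Finset.mem_range.1 hk)]
  have h2 : -h r ≤ ∑' j, h (j + (r + 1)) * y (j + (r + 1)) := by
    refine (neg_le_neg (hh.tail_le r)).trans ?_
    rw [← tsum_neg]
    refine (hh.summable_add (r + 1)).neg.tsum_le_tsum (fun j => ?_)
      ((summable_nat_add_iff (r + 1)).2 hs)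
    nlinarith [hh.pos (j + (r + 1)), (abs_le.1 (hy (j + (r + 1)))).1]
  linarith

theorem IsKernel.neg_of_consecutive (hh : IsKernel h) {t : ℕ → ℤ} {n m : ℕ}
    (ht : ∀ i ≥ n, |t i| ≤ 1) (hW : |corr h (fun i => (t i : ℝ)) n| < 1) (hnm : n < m)
    (hn : t n ≠ 0) (hm : t m ≠ 0) (hmid : ∀ i, n < i → i < m → t i = 0) : t m = -t n := by
  by_contra hne
  have htn := abs_le.1 (ht n le_rfl)
  have htm := abs_le.1 (ht m hnm.le)
  have heq : t m = t n := by omega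
  have hsq : (t n : ℝ) * t n = 1 := by
    have : t n = 1 ∨ t n = -1 := by omega
    rcases this with h | h <;> simp [h]
  obtain ⟨r, rfl⟩ := Nat.exists_eq_add_of_le hnm.le
  have habs : ∀ i ≥ n, |(t i : ℝ)| ≤ 1 := fun i hi => by exact_mod_cast ht i hi
  have h1 : 1 ≤ ∑' k, h k * ((t n : ℝ) * t (n + k)) := by
    refine hh.one_le_tsum (r := r) (fun k => ?_) (by omega) hsq (fun k h1 h2 => ?_)
      (by rw [heq, hsq])
    · rw [abs_mul]
      exact mul_le_one₀ (habs n le_rfl) (abs_nonneg _) (habs _ (Nat.le_add_right n k))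
    · rw [hmid (n + k) (by omega) (by omega)]; simp
  have h2 : ∑' k, h k * ((t n : ℝ) * t (n + k)) = t n * corr h (fun i => (t i : ℝ)) n := by
    rw [corr, ← tsum_mul_left]
    exact tsum_congr fun k => by ring
  rw [h2] at h1
  have h3 := h1.trans (le_abs_self _)
  rw [abs_mul] at h3
  nlinarith [habs n le_rfl, abs_nonneg (corr h (fun i => (t i : ℝ)) n)]

theorem IsKernel.exists_bit_sub (hh : IsKernel h) {t : ℕ → ℤ} {N : ℕ}
    (ht : ∀ n ≥ N, |t n| ≤ 1) (hW : ∀ n ≥ N, |corr h (fun i => (t i : ℝ)) n| < 1)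
    (hfreq : ∃ᶠ n in atTop, t n ≠ 0) :
    ∃ b : ℕ → Bool, ∀ n ≥ N, (t n : ℝ) = bit (b n) - bit (b (n + 1)) := by
  have hex : ∀ n, ∃ m ≥ n, t m ≠ 0 := fun n => (frequently_atTop.1 hfreq n)
  have hν : ∀ n, ∃ m ≥ n, t m ≠ 0 ∧ ∀ i, n ≤ i → i < m → t i = 0 := fun n => by
    classical
    obtain ⟨h1, h2⟩ := Nat.find_spec (hex n)
    refine ⟨Nat.find (hex n), h1, h2, fun i hi hlt => ?_⟩
    by_contra h
    exact Nat.find_min (hex n) hlt ⟨hi, h⟩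
  choose ν hge hne hz using hν
  -- `b n` records the sign of the first nonzero term at or after `n`; by alternation it changes
  -- exactly where `t` is nonzero.
  refine ⟨fun n => decide (t (ν n) = 1), fun n hn => ?_⟩
  have hle := hge (n + 1)
  by_cases h0 : t n = 0
  · have h1 : n < ν n := lt_of_le_of_ne (hge n) fun h => hne n (h ▸ h0)
    have h2 : ν n = ν (n + 1) := by
      rcases lt_trichotomy (ν n) (ν (n + 1)) with h | h | h
      · exact absurd (hz (n + 1) _ h1 h) (hne n)
      · exact h
      · exact absurd (hz n _ (by omega) h) (hne (n + 1))
    simp [h0, h2]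
  · have h1 : ν n = n := by
      by_contra h
      exact h0 (hz n n le_rfl (lt_of_le_of_ne (hge n) (Ne.symm h)))
    have h2 := hh.neg_of_consecutive (fun i hi => ht i (hn.trans hi)) (hW n hn)
      (m := ν (n + 1)) (by omega) h0 (hne (n + 1)) fun i hi hlt => hz (n + 1) i hi hlt
    simp only [h1, h2]
    have := abs_le.1 (ht n hn)
    have : t n = 1 ∨ t n = -1 := by omega
    rcases this with h | h <;> simp [h, bit]

theorem IsKernel.limsup_corr_eq (hh : IsKernel h) {t : ℕ → ℤ}
    (ht : ∀ᶠ n in atTop, |t n| ≤ 1)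
    (hW : ∀ᶠ n in atTop, |corr h (fun i => (t i : ℝ)) n| < 1)
    (hlim : limsup (fun n => |corr h (fun i => (t i : ℝ)) n|) atTop <
      wsum (weight h) thueMorse) :
    ∃ k, limsup (fun n => |corr h (fun i => (t i : ℝ)) n|) atTop = wsum (weight h) (per k) := by
  obtain ⟨N, hN⟩ := eventually_atTop.1 (ht.and hW)
  by_cases hfreq : ∃ᶠ n in atTop, t n ≠ 0
  · obtain ⟨b, hb⟩ := hh.exists_bit_sub (fun n hn => (hN n hn).1) (fun n hn => (hN n hn).2) hfreq
    have heq : limsup (fun n => |corr h (fun i => (t i : ℝ)) n|) atTop =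
        limsup (fun n => wsum (weight h) (rel b n)) atTop := by
      refine limsup_congr ?_
      filter_upwards [eventually_ge_atTop N] with n hn
      exact hh.abs_corr_bit_sub fun m hm => hb m (hn.trans hm)
    rw [heq] at hlim ⊢
    exact hh.isWeight.limsup_rel_eq hlim
  -- Here `t` is eventually zero; the limsup is 0, the digit sum of `per 0`.
  · refine ⟨0, ?_⟩
    rw [IsWeight.wsum_per_zero]
    have h0 : ∀ᶠ n in atTop, |corr h (fun i => (t i : ℝ)) n| = 0 := by
      obtain ⟨M, hM⟩ := eventually_atTop.1 (not_frequently.1 hfreq)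
      filter_upwards [eventually_ge_atTop M] with n hn
      have : ∀ k, t (n + k) = 0 := fun k => not_not.1 (hM (n + k) (by omega))
      simp [corr, this]
    exact limsup_eq_of_eventually_le_of_frequently_eq (h0.mono fun _ h => h.le) h0.frequently

theorem IsKernel.limsup_corr_per (hh : IsKernel h) {t : ℕ → ℤ} {k : ℕ}
    (ht : ∀ n, (t n : ℝ) = bit (per k n) - bit (per k (n + 1))) :
    (∀ n, |corr h (fun i => (t i : ℝ)) n| ≤ 1) ∧
      limsup (fun n => |corr h (fun i => (t i : ℝ)) n|) atTop = wsum (weight h) (per k) := by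
  have heq : ∀ n, |corr h (fun i => (t i : ℝ)) n| = wsum (weight h) (rel (per k) n) :=
    fun n => hh.abs_corr_bit_sub fun m _ => ht m
  simp only [heq]
  exact ⟨fun n => hh.wsum_le_one _, hh.isWeight.limsup_rel_per (M := 0) (a := false)
    fun i => by rw [zero_add]; rfl⟩

/-! ### Complete homogeneous symmetric polynomials as a kernel -/

section Kernel

variable {ι : Type*} [DecidableEq ι]

/-- The partial fraction coefficient `∏_{j ≠ i} β_i / (β_i - β_j)`. -/
noncomputable def pfCoeff (β : ι → ℝ) (s : Finset ι) (i : ι) : ℝ :=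
  ∏ j ∈ s.erase i, β i / (β i - β j)

/-- The complete homogeneous symmetric polynomials in `β`, in partial fraction form. -/
noncomputable def pfKernel (β : ι → ℝ) (s : Finset ι) (k : ℕ) : ℝ :=
  ∑ i ∈ s, pfCoeff β s i * β i ^ k

variable {β : ι → ℝ} {s : Finset ι}

theorem eval_zero_basis (hβ : ∀ i, β i ≠ 0) (hinj : Function.Injective β) (i : ι) :
    (Lagrange.basis s (fun i => (β i)⁻¹) i).eval 0 = pfCoeff β s i := by
  rw [Lagrange.basis, eval_prod, pfCoeff]
  refine Finset.prod_congr rfl fun j hj => ?_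
  have h1 := hβ i
  have h2 := hβ j
  have h3 : β i - β j ≠ 0 := sub_ne_zero.2 fun h => (Finset.ne_of_mem_erase hj) (hinj h).symm
  have h4 : β j - β i ≠ 0 := fun h => h3 (by linarith)
  rw [Lagrange.basisDivisor]
  simp only [eval_mul, eval_C, eval_sub, eval_X]
  rw [inv_sub_inv h1 h2]
  field_simp
  ring

/-- The Lagrange basis polynomials at the nodes `1/β_i` sum to 1; evaluate at 0. -/
theorem pfKernel_zero (hβ : ∀ i, β i ≠ 0) (hinj : Function.Injective β) (hs : s.Nonempty) :
    pfKernel β s 0 = 1 := by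
  have h := congrArg (eval 0) (Lagrange.sum_basis (s := s) (v := fun i => (β i)⁻¹)
    ((inv_injective.comp hinj).injOn) hs)
  rw [eval_finsetSum, eval_one] at h
  rw [← h, pfKernel]
  exact Finset.sum_congr rfl fun i _ => by rw [eval_zero_basis hβ hinj, pow_zero, mul_one]

theorem pfKernel_insert (hinj : Function.Injective β) {a : ι} (ha : a ∉ s) (k : ℕ) :
    pfKernel β (insert a s) (k + 1) =
      pfKernel β s (k + 1) + β a * pfKernel β (insert a s) k := by
  rw [← sub_eq_iff_eq_add, pfKernel, pfKernel, pfKernel, Finset.mul_sum, ← Finset.sum_sub_distrib,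
    Finset.sum_insert ha]
  rw [show ∀ x : ℝ, x * β a ^ (k + 1) - β a * (x * β a ^ k) = 0 by intro x; ring, zero_add]
  refine Finset.sum_congr rfl fun i hi => ?_
  have hne : i ≠ a := fun h => ha (h ▸ hi)
  have h3 : β i - β a ≠ 0 := sub_ne_zero.2 fun h => hne (hinj h)
  have h4 : pfCoeff β (insert a s) i = β i / (β i - β a) * pfCoeff β s i := by
    rw [pfCoeff, Finset.erase_insert_of_ne (Ne.symm hne), Finset.prod_insert, pfCoeff]
    exact fun h => ha (Finset.mem_of_mem_erase h)
  rw [h4]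
  field_simp
  ring

/-- Induction on the set of variables through the recurrence of `pfKernel_insert`: positivity is
then visible, the kernel grows with the set, and the ratio bound for `s` gains `β a` when `a` is
added. -/
theorem pfKernel_pos_and_succ_le (hβ : ∀ i, 0 < β i) (hinj : Function.Injective β)
    (hs : s.Nonempty) :
    ∀ k, 0 < pfKernel β s k ∧ pfKernel β s (k + 1) ≤ (∑ i ∈ s, β i) * pfKernel β s k := by
  have hne : ∀ i, β i ≠ 0 := fun i => (hβ i).ne'
  induction hs using Finset.Nonempty.cons_induction with
  | singleton a =>
    intro k
    have h : ∀ k, pfKernel β {a} k = β a ^ k := fun k => by simp [pfKernel, pfCoeff]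
    simp only [h, Finset.sum_singleton]
    exact ⟨pow_pos (hβ a) k, (pow_succ' _ _).le⟩
  | cons a s ha hs ih =>
    rw [Finset.cons_eq_insert]
    have hrec := pfKernel_insert hinj ha
    have h0 := pfKernel_zero hne hinj (Finset.insert_nonempty a s)
    have hpos : ∀ k, 0 < pfKernel β (insert a s) k := by
      intro k
      induction k with
      | zero => rw [h0]; exact one_pos
      | succ k ihk =>
        rw [hrec]
        exact add_pos (ih (k + 1)).1 (mul_pos (hβ a) ihk)
    have hle : ∀ k, pfKernel β s k ≤ pfKernel β (insert a s) k := by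
      rintro (_ | k)
      · rw [h0, pfKernel_zero hne hinj hs]
      · rw [hrec]
        exact le_add_of_nonneg_right (mul_pos (hβ a) (hpos k)).le
    have hσ : 0 ≤ ∑ i ∈ s, β i := Finset.sum_nonneg fun i _ => (hβ i).le
    intro k
    refine ⟨hpos k, ?_⟩
    rw [hrec, Finset.sum_insert ha, add_mul, add_comm]
    gcongr
    exact (ih k).2.trans (mul_le_mul_of_nonneg_left (hle k) hσ)

theorem isKernel_pfKernel (hβ : ∀ i, 0 < β i) (hinj : Function.Injective β) (hs : s.Nonempty)
    (hsum : ∑ i ∈ s, β i ≤ 1 / 2) : IsKernel (pfKernel β s) where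
  zero := pfKernel_zero (fun i => (hβ i).ne') hinj hs
  pos k := (pfKernel_pos_and_succ_le hβ hinj hs k).1
  succ_le k := by
    obtain ⟨h1, h2⟩ := pfKernel_pos_and_succ_le hβ hinj hs k
    nlinarith

end Kernel

/-! ### Polynomials in the shift and their inversion -/

/-- The shift operator on real sequences. -/
def shift : Module.End ℝ (ℕ → ℝ) := LinearMap.funLeft ℝ ℝ Nat.succ

theorem shift_pow_apply (j : ℕ) (y : ℕ → ℝ) (n : ℕ) : (shift ^ j) y n = y (n + j) := by
  induction j generalizing n with
  | zero => rfl
  | succ j ih =>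
    rw [pow_succ', Module.End.mul_apply]
    exact (ih (n + 1)).trans (congrArg y (by omega))

theorem aeval_shift_apply (p : ℝ[X]) (y : ℕ → ℝ) (n : ℕ) :
    aeval shift p y n = ∑ j ∈ Finset.range (p.natDegree + 1), p.coeff j * y (n + j) := by
  rw [aeval_eq_sum_range, LinearMap.sum_apply, Finset.sum_apply]
  exact Finset.sum_congr rfl fun j _ => by
    rw [LinearMap.smul_apply, Pi.smul_apply, shift_pow_apply, smul_eq_mul]

theorem aeval_shift_X_sub_C (a : ℝ) (y : ℕ → ℝ) (n : ℕ) :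
    aeval shift (X - C a) y n = y (n + 1) - a * y n := by
  rw [map_sub, aeval_X, aeval_C, LinearMap.sub_apply, Pi.sub_apply,
    Module.algebraMap_end_apply, Pi.smul_apply, smul_eq_mul]
  rfl

theorem aeval_shift_pow (p : ℝ[X]) (g a : ℝ) (n : ℕ) :
    aeval shift p (fun n => g * a ^ n) n = p.eval a * (g * a ^ n) := by
  rw [aeval_shift_apply, eval_eq_sum_range, Finset.sum_mul]
  exact Finset.sum_congr rfl fun j _ => by ring

/-- Boundedness of a real sequence. -/
def IsBdd (y : ℕ → ℝ) : Prop := ∃ C, ∀ n, |y n| ≤ C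

theorem IsBdd.aeval_shift {y : ℕ → ℝ} (hy : IsBdd y) (p : ℝ[X]) : IsBdd (aeval shift p y) := by
  obtain ⟨C, hC⟩ := hy
  refine ⟨∑ j ∈ Finset.range (p.natDegree + 1), |p.coeff j| * C, fun n => ?_⟩
  rw [aeval_shift_apply]
  refine (Finset.abs_sum_le_sum_abs _ _).trans (Finset.sum_le_sum fun j _ => ?_)
  rw [abs_mul]
  exact mul_le_mul_of_nonneg_left (hC _) (abs_nonneg _)

section Geometric

variable {b : ℝ} {y : ℕ → ℝ}

theorem summable_geom_mul (hb0 : 0 ≤ b) (hb1 : b < 1) (hy : IsBdd y) (n : ℕ) :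
    Summable fun k => b ^ k * y (n + k) := by
  obtain ⟨C, hC⟩ := hy
  refine ((summable_geometric_of_lt_one hb0 hb1).mul_right C).of_norm_bounded fun k => ?_
  rw [Real.norm_eq_abs, abs_mul, abs_of_nonneg (pow_nonneg hb0 k)]
  exact mul_le_mul_of_nonneg_left (hC _) (pow_nonneg hb0 k)

theorem corr_pow_eq (hb0 : 0 ≤ b) (hb1 : b < 1) (hy : IsBdd y) (n : ℕ) :
    corr (fun k => b ^ k) y n = y n + b * corr (fun k => b ^ k) y (n + 1) := by
  rw [corr, (summable_geom_mul hb0 hb1 hy n).tsum_eq_zero_add, corr, ← tsum_mul_left]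
  congr 1
  · simp
  · refine tsum_congr fun k => ?_
    rw [show n + (k + 1) = n + 1 + k by ring, pow_succ']
    ring

theorem aeval_X_sub_C_corr_pow (hb0 : 0 < b) (hb1 : b < 1) (hy : IsBdd y) :
    aeval shift (X - C b⁻¹) (corr (fun k => b ^ k) y) = -b⁻¹ • y := by
  funext n
  rw [aeval_shift_X_sub_C, corr_pow_eq hb0.le hb1 hy n, Pi.smul_apply, smul_eq_mul]
  field_simp
  ring

theorem corr_pow_aeval_X_sub_C (hb0 : 0 < b) (hb1 : b < 1) (hy : IsBdd y) :
    corr (fun k => b ^ k) (aeval shift (X - C b⁻¹) y) = -b⁻¹ • y := by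
  funext n
  have h1 := summable_geom_mul hb0.le hb1 hy n
  have h2 := summable_geom_mul hb0.le hb1 hy (n + 1)
  have h3 : corr (fun k => b ^ k) (aeval shift (X - C b⁻¹) y) n =
      corr (fun k => b ^ k) y (n + 1) - b⁻¹ * corr (fun k => b ^ k) y n := by
    rw [corr, corr, corr, ← tsum_mul_left, ← h2.tsum_sub (h1.mul_left _)]
    refine tsum_congr fun k => ?_
    rw [aeval_shift_X_sub_C, show n + k + 1 = n + 1 + k by ring]
    ring
  rw [h3, corr_pow_eq hb0.le hb1 hy n, Pi.smul_apply, smul_eq_mul]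
  field_simp
  ring

end Geometric

section Inversion

theorem aeval_nodal_sum_pow {ι : Type*} {s : Finset ι} {α : ι → ℝ} (g : ι → ℝ) :
    aeval shift (Lagrange.nodal s α) (fun n => ∑ i ∈ s, g i * α i ^ n) = 0 := by
  have h : (fun n => ∑ i ∈ s, g i * α i ^ n) = ∑ i ∈ s, fun n => g i * α i ^ n := by
    funext n; rw [Finset.sum_apply]
  rw [h, map_sum]
  refine Finset.sum_eq_zero fun i hi => ?_
  funext n
  rw [aeval_shift_pow, Lagrange.eval_nodal_at_node hi, zero_mul, Pi.zero_apply]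

variable {ι : Type*} [DecidableEq ι] {β : ι → ℝ} {s : Finset ι} {y : ℕ → ℝ}

theorem corr_pfKernel (hβ0 : ∀ i, 0 < β i) (hβ1 : ∀ i, β i < 1) (hy : IsBdd y) :
    corr (pfKernel β s) y = ∑ i ∈ s, pfCoeff β s i • corr (fun k => β i ^ k) y := by
  funext n
  rw [Finset.sum_apply, corr]
  simp only [Pi.smul_apply, smul_eq_mul, corr, pfKernel, ← tsum_mul_left]
  rw [← Summable.tsum_finsetSum fun i _ =>
    (summable_geom_mul (hβ0 i).le (hβ1 i) hy n).mul_left (pfCoeff β s i)]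
  refine tsum_congr fun k => ?_
  rw [Finset.sum_mul]
  exact Finset.sum_congr rfl fun i _ => by ring

theorem basis_eq_nodalWeight_mul (v : ι → ℝ) {i : ι} (hi : i ∈ s) :
    Lagrange.basis s v i = C (Lagrange.nodalWeight s v i) * Lagrange.nodal (s.erase i) v := by
  rw [Lagrange.basis_eq_prod_sub_inv_mul_nodal_div hi, Lagrange.nodal_erase_eq_nodal_div hi]

/-- Each partial fraction, cleared of denominators, is a multiple of a Lagrange basis polynomial
with a factor independent of `i`; so the fractions add up to a constant. -/
theorem pfCoeff_mul_nodal_erase (hβ : ∀ i, β i ≠ 0) (hinj : Function.Injective β) {i : ι}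
    (hi : i ∈ s) :
    C (pfCoeff β s i * -(β i)⁻¹) * Lagrange.nodal (s.erase i) (fun i => (β i)⁻¹) =
      C ((Lagrange.nodal s fun i => (β i)⁻¹).eval 0) *
        Lagrange.basis s (fun i => (β i)⁻¹) i := by
  rw [← eval_zero_basis hβ hinj, basis_eq_nodalWeight_mul _ hi,
    Lagrange.nodal_eq_mul_nodal_erase hi]
  simp only [eval_mul, eval_sub, eval_X, eval_C, C_mul, zero_sub]
  ring

theorem sum_aeval_nodal_erase (hβ : ∀ i, β i ≠ 0) (hinj : Function.Injective β) (hs : s.Nonempty)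
    (y : ℕ → ℝ) :
    ∑ i ∈ s, pfCoeff β s i • -(β i)⁻¹ •
        aeval shift (Lagrange.nodal (s.erase i) fun i => (β i)⁻¹) y =
      (Lagrange.nodal s fun i => (β i)⁻¹).eval 0 • y := by
  have h : ∀ i ∈ s, pfCoeff β s i • -(β i)⁻¹ •
        aeval shift (Lagrange.nodal (s.erase i) fun i => (β i)⁻¹) y =
      (Lagrange.nodal s fun i => (β i)⁻¹).eval 0 •
        aeval shift (Lagrange.basis s (fun i => (β i)⁻¹) i) y := by
    intro i hi
    have h := congrArg (fun p => aeval shift p y) (pfCoeff_mul_nodal_erase hβ hinj hi)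
    simpa only [← smul_eq_C_mul, map_smul, LinearMap.smul_apply, mul_smul] using h
  rw [Finset.sum_congr rfl h, ← Finset.smul_sum, ← LinearMap.sum_apply, ← map_sum,
    Lagrange.sum_basis (v := fun i => (β i)⁻¹) ((inv_injective.comp hinj).injOn) hs,
    map_one, Module.End.one_apply]

/-- Each geometric correlation inverts one factor `X - 1/β_i` up to a scalar, and partial fractions
assemble them. This order of composition builds `ε` from `t`; the reverse order, in
`corr_pfKernel_aeval_nodal`, recovers a bounded `ε` from `t`. -/
theorem aeval_nodal_corr_pfKernel (hβ0 : ∀ i, 0 < β i) (hβ1 : ∀ i, β i < 1)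
    (hinj : Function.Injective β) (hs : s.Nonempty) (hy : IsBdd y) :
    aeval shift (Lagrange.nodal s fun i => (β i)⁻¹) (corr (pfKernel β s) y) =
      (Lagrange.nodal s fun i => (β i)⁻¹).eval 0 • y := by
  rw [corr_pfKernel hβ0 hβ1 hy, map_sum,
    ← sum_aeval_nodal_erase (fun i => (hβ0 i).ne') hinj hs]
  refine Finset.sum_congr rfl fun i hi => ?_
  rw [map_smul, Lagrange.nodal_eq_mul_nodal_erase hi, mul_comm, map_mul, Module.End.mul_apply,
    aeval_X_sub_C_corr_pow (hβ0 i) (hβ1 i) hy, map_smul]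

theorem corr_pfKernel_aeval_nodal (hβ0 : ∀ i, 0 < β i) (hβ1 : ∀ i, β i < 1)
    (hinj : Function.Injective β) (hs : s.Nonempty) (hy : IsBdd y) :
    corr (pfKernel β s) (aeval shift (Lagrange.nodal s fun i => (β i)⁻¹) y) =
      (Lagrange.nodal s fun i => (β i)⁻¹).eval 0 • y := by
  rw [corr_pfKernel hβ0 hβ1 (hy.aeval_shift _),
    ← sum_aeval_nodal_erase (fun i => (hβ0 i).ne') hinj hs]
  refine Finset.sum_congr rfl fun i hi => ?_
  rw [Lagrange.nodal_eq_mul_nodal_erase hi, map_mul, Module.End.mul_apply,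
    corr_pow_aeval_X_sub_C (hβ0 i) (hβ1 i) (hy.aeval_shift _)]

/-- The Lagrange basis, applied in the shift, splits `y` into components, each killed by one factor
`X - α_i` and hence geometric. -/
theorem exists_eq_sum_pow_of_aeval_nodal_eq_zero {α : ι → ℝ} (hinj : Function.Injective α)
    (hs : s.Nonempty) (hy : aeval shift (Lagrange.nodal s α) y = 0) :
    ∃ g : ι → ℝ, ∀ n, y n = ∑ i ∈ s, g i * α i ^ n := by
  have h : ∀ i ∈ s, ∀ n, aeval shift (Lagrange.basis s α i) y n =
      aeval shift (Lagrange.basis s α i) y 0 * α i ^ n := by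
    intro i hi
    have h0 : aeval shift (X - C (α i)) (aeval shift (Lagrange.basis s α i) y) = 0 := by
      rw [← Module.End.mul_apply, ← map_mul, basis_eq_nodalWeight_mul _ hi, mul_left_comm,
        ← Lagrange.nodal_eq_mul_nodal_erase hi, map_mul, Module.End.mul_apply, hy, map_zero]
    intro n
    induction n with
    | zero => simp
    | succ n ih =>
      have h1 := congrFun h0 n
      rw [aeval_shift_X_sub_C, Pi.zero_apply, sub_eq_zero, ih] at h1
      rw [h1, pow_succ]
      ring
  refine ⟨fun i => aeval shift (Lagrange.basis s α i) y 0, fun n => ?_⟩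
  rw [← Finset.sum_congr rfl fun i hi => h i hi n, ← Finset.sum_apply, ← LinearMap.sum_apply,
    ← map_sum, Lagrange.sum_basis hinj.injOn hs,
    map_one, Module.End.one_apply]

theorem abs_aeval_nodal_le {α : ι → ℝ} (hα : ∀ i, 0 ≤ α i) {M : ℝ} {N : ℕ}
    (hy : ∀ n ≥ N, |y n| ≤ M) :
    ∀ n ≥ N, |aeval shift (Lagrange.nodal s α) y n| ≤ (∏ i ∈ s, (1 + α i)) * M := by
  induction s using Finset.induction_on with
  | empty => simpa using hy
  | insert a s ha ih =>
    intro n hn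
    rw [Lagrange.nodal_insert_eq_nodal ha, map_mul, Module.End.mul_apply, aeval_shift_X_sub_C,
      Finset.prod_insert ha]
    refine (abs_sub _ _).trans ?_
    rw [abs_mul, abs_of_nonneg (hα a)]
    nlinarith [ih n hn, ih (n + 1) (by omega), hα a]

end Inversion

/-! ### Closed forms for the digit sums -/

theorem isKernel_pow {x : ℝ} (hx0 : 0 < x) (hx : x ≤ 1 / 2) : IsKernel fun k => x ^ k where
  zero := pow_zero x
  pos k := pow_pos hx0 k
  succ_le k := by
    rw [pow_succ]
    nlinarith [pow_pos hx0 k]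

/-- The generating function of the signs `(-1) ^ e_n`. -/
noncomputable def signSeries (e : ℕ → Bool) (x : ℝ) : ℝ := ∑' n, x ^ n * (1 - 2 * bit (e n))

theorem abs_sign_le (a : Bool) : |1 - 2 * bit a| ≤ 1 := by cases a <;> simp [bit]; norm_num

theorem summable_sign {x : ℝ} (hx0 : 0 ≤ x) (hx1 : x < 1) (e : ℕ → Bool) :
    Summable fun n => x ^ n * (1 - 2 * bit (e n)) := by
  refine (summable_geometric_of_lt_one hx0 hx1).of_norm_bounded fun n => ?_
  rw [Real.norm_eq_abs, abs_mul, abs_of_nonneg (pow_nonneg hx0 n)]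
  exact mul_le_of_le_one_right (pow_nonneg hx0 n) (abs_sign_le _)

theorem signSeries_dbl {x : ℝ} (hx0 : 0 ≤ x) (hx1 : x < 1) (c : ℕ → Bool) :
    signSeries (dbl c) x = (1 - x) * signSeries c (x ^ 2) := by
  have hs := summable_sign (pow_nonneg hx0 2) (pow_lt_one₀ hx0 hx1 two_ne_zero) c
  have he : ∀ k, x ^ (2 * k) * (1 - 2 * bit (dbl c (2 * k))) =
      (x ^ 2) ^ k * (1 - 2 * bit (c k)) := fun k => by rw [dbl_even, pow_mul]
  have ho : ∀ k, x ^ (2 * k + 1) * (1 - 2 * bit (dbl c (2 * k + 1))) =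
      -x * ((x ^ 2) ^ k * (1 - 2 * bit (c k))) := fun k => by
    rw [dbl_odd, bit_not, pow_succ, pow_mul]; ring
  rw [signSeries, ← tsum_even_add_odd (hs.congr fun k => (he k).symm)
    ((hs.mul_left (-x)).congr fun k => (ho k).symm), tsum_congr he, tsum_congr ho, tsum_mul_left,
    signSeries]
  ring

theorem signSeries_dbl_iterate {x : ℝ} (hx0 : 0 ≤ x) (hx1 : x < 1) (k : ℕ) (c : ℕ → Bool) :
    signSeries (dbl^[k] c) x =
      (∏ m ∈ Finset.range k, (1 - x ^ 2 ^ m)) * signSeries c (x ^ 2 ^ k) := by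
  induction k generalizing c with
  | zero => simp
  | succ k ih =>
    rw [Function.iterate_succ_apply, ih, signSeries_dbl (pow_nonneg hx0 _)
      (pow_lt_one₀ hx0 hx1 (by positivity)), Finset.prod_range_succ, ← pow_mul, ← pow_succ,
      mul_assoc]

/-- The last of the `k + 1` product factors cancels against the geometric series in `x ^ 2 ^ (k +
1)`, leaving only `1 + x ^ 2 ^ k` below. -/
theorem signSeries_per_succ {x : ℝ} (hx0 : 0 ≤ x) (hx1 : x < 1) (k : ℕ) :
    signSeries (per (k + 1)) x =
      (∏ m ∈ Finset.range k, (1 - x ^ 2 ^ m)) / (1 + x ^ 2 ^ k) := by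
  have h0 : 0 ≤ x ^ 2 ^ k := pow_nonneg hx0 _
  have h1 : x ^ 2 ^ k < 1 := pow_lt_one₀ hx0 hx1 (by positivity)
  have h2 : signSeries (fun _ => false) (x ^ 2 ^ (k + 1)) = (1 - (x ^ 2 ^ k) ^ 2)⁻¹ := by
    rw [pow_succ 2 k, pow_mul, ← tsum_geometric_of_lt_one (pow_nonneg h0 2)
      (pow_lt_one₀ h0 h1 two_ne_zero), signSeries]
    exact tsum_congr fun n => by simp [bit]
  rw [per, signSeries_dbl_iterate hx0 hx1, Finset.prod_range_succ, h2]
  have h3 : 1 - x ^ 2 ^ k ≠ 0 := by linarith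
  have h4 : 1 + x ^ 2 ^ k ≠ 0 := by linarith
  rw [show 1 - (x ^ 2 ^ k) ^ 2 = (1 - x ^ 2 ^ k) * (1 + x ^ 2 ^ k) by ring]
  field_simp

theorem wsum_weight_pow {x : ℝ} (hx0 : 0 < x) (hx : x ≤ 1 / 2) {e : ℕ → Bool}
    (he : e 0 = false) :
    wsum (weight fun k => x ^ k) e = (1 - (1 - x) * signSeries e x) / (2 * x) := by
  have hx1 : x < 1 := by linarith
  have s1 := summable_sign hx0.le hx1 e
  have s2 := summable_sign hx0.le hx1 fun n => e (n + 1)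
  have h1 : signSeries e x = 1 + x * ∑' n, x ^ n * (1 - 2 * bit (e (n + 1))) := by
    rw [signSeries, s1.tsum_eq_zero_add, ← tsum_mul_left, he]
    congr 1
    · simp [bit]
    · exact tsum_congr fun n => by ring
  have h2 : wsum (weight fun k => x ^ k) e =
      (signSeries e x - ∑' n, x ^ n * (1 - 2 * bit (e (n + 1)))) / 2 := by
    rw [← (isKernel_pow hx0 hx).tsum_bit_sub he, signSeries, ← s1.tsum_sub s2, ← tsum_div_const]
    exact tsum_congr fun n => by ring
  rw [h2, div_eq_div_iff (by norm_num) (by positivity)]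
  linear_combination 2 * h1

theorem Efin_eq_wsum {x : ℝ} (hx0 : 0 < x) (hx : x ≤ 1 / 2) (k : ℕ) :
    Efin k x = wsum (weight fun k => x ^ k) (per (k + 1)) := by
  have h4 : 0 < 1 + x ^ 2 ^ k := by positivity
  rw [wsum_weight_pow hx0 hx (per_zero_apply _), signSeries_per_succ hx0.le (by linarith), Efin]
  field_simp

theorem tendsto_pow_two_pow {x : ℝ} (hx0 : 0 ≤ x) (hx1 : x < 1) :
    Tendsto (fun k : ℕ => x ^ 2 ^ k) atTop (𝓝 0) :=
  (tendsto_pow_atTop_nhds_zero_of_lt_one hx0 hx1).comp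
    (tendsto_atTop_mono (fun _ => Nat.lt_two_pow_self.le) tendsto_id)

theorem multipliable_one_sub_pow_two_pow {x : ℝ} (hx0 : 0 ≤ x) (hx1 : x < 1) :
    Multipliable fun m : ℕ => 1 - x ^ 2 ^ m := by
  have h : Summable fun m : ℕ => -x ^ 2 ^ m :=
    ((summable_geometric_of_lt_one hx0 hx1).of_nonneg_of_le (fun _ => pow_nonneg hx0 _)
      fun m => pow_le_pow_of_le_one hx0 hx1.le Nat.lt_two_pow_self.le).neg
  simpa only [sub_eq_add_neg] using Real.multipliable_one_add_of_summable h

theorem tendsto_Efin {x : ℝ} (hx0 : 0 < x) (hx1 : x < 1) :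
    Tendsto (fun k => Efin k x) atTop (𝓝 (E x)) := by
  have h1 := tendsto_pow_two_pow hx0.le hx1
  have h2 := (multipliable_one_sub_pow_two_pow hx0.le hx1).tendsto_prod_tprod_nat
  have h3 := ((h1.const_add 1).sub (h2.const_mul (1 - x))).div
    ((h1.const_add 1).const_mul (2 * x)) (by simp [hx0.ne'])
  simpa only [Efin, E, add_zero, mul_one, Pi.div_def] using h3

/-- Both sides are the limit of `Efin k x`. -/
theorem E_eq_wsum {x : ℝ} (hx0 : 0 < x) (hx : x ≤ 1 / 2) :
    E x = wsum (weight fun k => x ^ k) thueMorse := by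
  refine tendsto_nhds_unique (tendsto_Efin hx0 (by linarith)) ?_
  simp_rw [Efin_eq_wsum hx0 hx]
  exact (isKernel_pow hx0 hx).isWeight.tendsto_wsum_per.comp (tendsto_add_atTop_nat 1)

theorem wsum_weight_pfKernel {ι : Type*} [DecidableEq ι] {β : ι → ℝ} {s : Finset ι}
    (hβ0 : ∀ i, 0 < β i) (hβ : ∀ i, β i ≤ 1 / 2) (e : ℕ → Bool) :
    wsum (weight (pfKernel β s)) e =
      ∑ i ∈ s, pfCoeff β s i * wsum (weight fun k => β i ^ k) e := by
  simp only [wsum, ← tsum_mul_left]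
  rw [← Summable.tsum_finsetSum fun i _ =>
    ((isKernel_pow (hβ0 i) (hβ i)).isWeight.summable_bit e).mul_left (pfCoeff β s i)]
  refine tsum_congr fun k => ?_
  rw [weight, pfKernel, pfKernel, ← Finset.sum_sub_distrib, Finset.sum_mul]
  exact Finset.sum_congr rfl fun i _ => by rw [weight]; ring

section Multi

variable {r : ℕ} {β : Fin r → ℝ}

theorem Emulti_eq_wsum (hβ0 : ∀ i, 0 < β i) (hβ : ∀ i, β i ≤ 1 / 2) :
    Emulti β = wsum (weight (pfKernel β Finset.univ)) thueMorse := by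
  rw [wsum_weight_pfKernel hβ0 hβ, Emulti]
  exact Finset.sum_congr rfl fun i _ => by rw [E_eq_wsum (hβ0 i) (hβ i), pfCoeff]

theorem EmultiFin_eq_wsum (hβ0 : ∀ i, 0 < β i) (hβ : ∀ i, β i ≤ 1 / 2) (k : ℕ) :
    EmultiFin k β = wsum (weight (pfKernel β Finset.univ)) (per (k + 1)) := by
  rw [wsum_weight_pfKernel hβ0 hβ, EmultiFin]
  exact Finset.sum_congr rfl fun i _ => by rw [Efin_eq_wsum (hβ0 i) (hβ i), pfCoeff]

end Multi

/-! ### Scaling limsups, nearest integers and integer recurrences -/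

theorem limsup_const_mul_of_abs_le {u : ℕ → ℝ} {a C : ℝ} (ha : 0 < a) (hu : ∀ n, |u n| ≤ C) :
    limsup (fun n => a * u n) atTop = a * limsup u atTop := by
  have b1 : IsBoundedUnder (· ≤ ·) atTop u := isBoundedUnder_of ⟨C, fun n => (abs_le.1 (hu n)).2⟩
  have b2 : IsBoundedUnder (· ≥ ·) atTop u := isBoundedUnder_of ⟨-C, fun n => (abs_le.1 (hu n)).1⟩
  have hau : ∀ n, |a * u n| ≤ a * C := fun n => by
    rw [abs_mul, abs_of_pos ha]; exact mul_le_mul_of_nonneg_left (hu n) ha.le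
  have c1 : IsBoundedUnder (· ≤ ·) atTop fun n => a * u n :=
    isBoundedUnder_of ⟨a * C, fun n => (abs_le.1 (hau n)).2⟩
  have c2 : IsBoundedUnder (· ≥ ·) atTop fun n => a * u n :=
    isBoundedUnder_of ⟨-(a * C), fun n => (abs_le.1 (hau n)).1⟩
  exact ((OrderIso.mulLeft₀ a ha).limsup_apply b1 b2.isCoboundedUnder_le c1
    c2.isCoboundedUnder_le).symm

theorem distInt_nonneg (x : ℝ) : 0 ≤ distInt x := abs_nonneg _

theorem distInt_le_half (x : ℝ) : distInt x ≤ 1 / 2 := abs_sub_round x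

theorem distInt_intCast_add (u : ℤ) {x : ℝ} (hx : |x| ≤ 1 / 2) : distInt (u + x) = |x| := by
  have h1 : distInt (u + x) = |x - round x| := by
    rw [distInt, round_intCast_add]; push_cast; congr 1; ring
  rw [h1]
  refine le_antisymm (by simpa using round_le x 0) ?_
  by_cases h : round x = 0
  · simp [h]
  · have h2 : (1 : ℝ) ≤ |(round x : ℝ)| := by exact_mod_cast Int.one_le_abs h
    have h3 := abs_sub_abs_le_abs_sub (round x : ℝ) x
    rw [abs_sub_comm] at h3
    linarith

/-- A solution of the inhomogeneous linear recurrence with monic characteristic polynomial `p`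
and right-hand side `t`. -/
def solveRec (p : ℤ[X]) (t : ℕ → ℤ) (n : ℕ) : ℤ :=
  if _ : n < p.natDegree then 0
  else t (n - p.natDegree) -
    ∑ j : Fin p.natDegree, p.coeff j * solveRec p t (n - p.natDegree + j)
termination_by n
decreasing_by omega

theorem sum_coeff_mul_solveRec {p : ℤ[X]} (hp : p.Monic) (t : ℕ → ℤ) (n : ℕ) :
    ∑ j ∈ Finset.range (p.natDegree + 1), p.coeff j * solveRec p t (n + j) = t n := by
  rw [Finset.sum_range_succ, hp.coeff_natDegree, one_mul, solveRec.eq_1 p t (n + p.natDegree),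
    dif_neg (by omega), Nat.add_sub_cancel,
    Finset.sum_range fun j => p.coeff j * solveRec p t (n + j)]
  ring

theorem aeval_shift_map_intCast (p : ℤ[X]) (u : ℕ → ℤ) (n : ℕ) :
    aeval shift (p.map (Int.castRingHom ℝ)) (fun n => (u n : ℝ)) n =
      ((∑ j ∈ Finset.range (p.natDegree + 1), p.coeff j * u (n + j) : ℤ) : ℝ) := by
  rw [aeval_shift_apply, natDegree_map_eq_of_injective (RingHom.injective_int _)]
  push_cast
  exact Finset.sum_congr rfl fun j _ => by rw [coeff_map, eq_intCast]

/-! ### The spectrum of `P` -/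

section Polynomial

variable {P : ℤ[X]} {d : ℕ} {α : Fin d → ℝ}

theorem map_eq_nodal (hP : P.Monic)
    (hroots : P.aroots ℂ = Finset.univ.val.map (fun i : Fin d => (α i : ℂ))) :
    P.map (Int.castRingHom ℝ) = Lagrange.nodal Finset.univ α := by
  apply Polynomial.map_injective Complex.ofRealHom Complex.ofRealHom.injective
  rw [Polynomial.map_map, Lagrange.nodal_eq, Polynomial.map_prod]
  have h1 : Complex.ofRealHom.comp (Int.castRingHom ℝ) = algebraMap ℤ ℂ :=
    RingHom.ext_int _ _
  rw [h1, (IsAlgClosed.splits (P.map (algebraMap ℤ ℂ))).eq_prod_roots_of_monic (hP.map _),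
    ← aroots_def, hroots, Multiset.map_map, Finset.prod_eq_multiset_prod]
  simp

theorem expandingRoots_eq (hroots : P.aroots ℂ = Finset.univ.val.map (fun i : Fin d => (α i : ℂ)))
    (hα : ∀ i, 1 < α i) :
    expandingRoots P = Finset.univ.image fun i : Fin d => (α i : ℂ) := by
  ext z
  simp only [expandingRoots, hroots, Finset.mem_filter, Multiset.mem_toFinset, Multiset.mem_map,
    Finset.mem_val, Finset.mem_image]
  constructor
  · exact fun h => h.1
  · rintro ⟨i, hi, rfl⟩
    refine ⟨⟨i, hi, rfl⟩, ?_⟩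
    rw [Complex.norm_real, Real.norm_eq_abs]
    exact (hα i).trans_le (le_abs_self _)

theorem mem_spectrum_iff (hd : 1 ≤ d)
    (hroots : P.aroots ℂ = Finset.univ.val.map (fun i : Fin d => (α i : ℂ)))
    (hsimple : Function.Injective α) (hα : ∀ i, 1 < α i) (v : ℝ) :
    v ∈ spectrum P ↔ ∃ y : ℕ → ℝ, aeval shift (Lagrange.nodal Finset.univ α) y = 0 ∧
      v = limsup (fun n => distInt (y n)) atTop := by
  have hinj : Function.Injective fun i : Fin d => (α i : ℂ) :=
    Complex.ofReal_injective.comp hsimple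
  have hne : (Finset.univ : Finset (Fin d)).Nonempty := ⟨⟨0, hd⟩, Finset.mem_univ _⟩
  have hrec : ∀ (g : ℂ → ℂ[X]), g ∈ coeffFamilies 0 P → ∀ n : ℕ,
      recurrence P g n = ∑ i, ((g (α i)).coeff 0).re * α i ^ n := by
    intro g hg n
    rw [recurrence, expandingRoots_eq hroots hα, Finset.sum_image hinj.injOn, Complex.re_sum]
    refine Finset.sum_congr rfl fun i _ => ?_
    have hmem : (α i : ℂ) ∈ expandingRoots P := by
      rw [expandingRoots_eq hroots hα]; exact Finset.mem_image_of_mem _ (Finset.mem_univ i)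
    rw [eq_C_of_natDegree_le_zero (hg _ hmem).1]
    simp only [eval_C, coeff_C_zero]
    rw [zpow_natCast, ← Complex.ofReal_pow, Complex.re_mul_ofReal]
  constructor
  · rintro ⟨g, hg, rfl⟩
    refine ⟨_, aeval_nodal_sum_pow fun i => ((g (α i)).coeff 0).re, ?_⟩
    simp only [hrec g hg]
  · rintro ⟨y, hy, rfl⟩
    obtain ⟨r, hr⟩ := exists_eq_sum_pow_of_aeval_nodal_eq_zero hsimple hne hy
    have hext : ∀ i, Function.extend (fun i : Fin d => (α i : ℂ)) (fun i => (r i : ℂ)) 0 (α i) =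
        r i := fun i => hinj.extend_apply _ _ i
    set G := Function.extend (fun i : Fin d => (α i : ℂ)) (fun i => (r i : ℂ)) 0 with hG
    have hg : (fun z => C (G z)) ∈ coeffFamilies 0 P := by
      intro z hz
      rw [expandingRoots_eq hroots hα] at hz
      obtain ⟨i, -, rfl⟩ := Finset.mem_image.1 hz
      refine ⟨(natDegree_C _).le, ?_⟩
      simp only [Complex.conj_ofReal, hext, map_C]
    refine ⟨_, hg, ?_⟩
    simp only [hrec _ hg, hext, coeff_C_zero, Complex.ofReal_re, hr]

theorem prod_one_add_le_two_mul_prod {ι : Type*} (s : Finset ι) {α : ι → ℝ} (hα : ∀ i, 1 < α i)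
    (hsum : ∑ i ∈ s, (α i)⁻¹ ≤ 1 / 2) : ∏ i ∈ s, (1 + α i) ≤ 2 * ∏ i ∈ s, α i := by
  classical
  have hpos : ∀ i, 0 < α i := fun i => one_pos.trans (hα i)
  -- Dividing by `∏ α_i`, this reads `∏ (1 + β_i) * (1 - ∑ β_i) ≤ 1`; the second factor is at least
  -- 1/2 on `s`.
  have key : ∀ t : Finset ι, (∏ i ∈ t, (1 + α i)) * (1 - ∑ i ∈ t, (α i)⁻¹) ≤ ∏ i ∈ t, α i := by
    intro t
    induction t using Finset.induction_on with
    | empty => simp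
    | insert a t ha ih =>
      rw [Finset.prod_insert ha, Finset.prod_insert ha, Finset.sum_insert ha]
      have h1 : 0 ≤ ∏ i ∈ t, (1 + α i) := Finset.prod_nonneg fun i _ => by linarith [hpos i]
      have h2 : 0 ≤ ∑ i ∈ t, (α i)⁻¹ := Finset.sum_nonneg fun i _ => (inv_pos.2 (hpos i)).le
      have h3 : (1 + α a) * (1 - ((α a)⁻¹ + ∑ i ∈ t, (α i)⁻¹)) ≤
          α a * (1 - ∑ i ∈ t, (α i)⁻¹) := by
        have h4 : α a * (α a)⁻¹ = 1 := mul_inv_cancel₀ (hpos a).ne'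
        nlinarith [inv_pos.2 (hpos a)]
      nlinarith [hpos a, mul_le_mul_of_nonneg_left h3 h1, mul_le_mul_of_nonneg_left ih (hpos a).le]
  have h1 : 0 ≤ ∏ i ∈ s, (1 + α i) := Finset.prod_nonneg fun i _ => by linarith [hpos i]
  nlinarith [key s]

theorem eval_zero_nodal (hP : P.Monic)
    (hroots : P.aroots ℂ = Finset.univ.val.map (fun i : Fin d => (α i : ℂ))) :
    (Lagrange.nodal Finset.univ α).eval 0 = P.coeff 0 := by
  rw [← map_eq_nodal hP hroots, ← coeff_zero_eq_eval_zero, coeff_map, eq_intCast]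

theorem abs_coeff_zero (hP : P.Monic)
    (hroots : P.aroots ℂ = Finset.univ.val.map (fun i : Fin d => (α i : ℂ)))
    (hα : ∀ i, 1 < α i) : |(P.coeff 0 : ℝ)| = ∏ i, α i := by
  rw [← eval_zero_nodal hP hroots, Lagrange.eval_nodal, Finset.abs_prod]
  exact Finset.prod_congr rfl fun i _ => by
    rw [zero_sub, abs_neg, abs_of_pos (one_pos.trans (hα i))]

theorem inv_le_half (hα : ∀ i, 1 < α i) (hsum : ∑ i, (α i)⁻¹ ≤ 1 / 2) (i : Fin d) :
    (α i)⁻¹ ≤ 1 / 2 :=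
  (Finset.single_le_sum (f := fun i => (α i)⁻¹)
    (fun i _ => (inv_pos.2 (one_pos.trans (hα i))).le) (Finset.mem_univ i)).trans hsum

/-- Ensures that the `ε` constructed from `per k` stays within 1/2, so that `|ε n|` is the distance
to the nearest integer. -/
theorem inv_abs_coeff_zero_le_half (hP : P.Monic) (hd : 1 ≤ d)
    (hroots : P.aroots ℂ = Finset.univ.val.map (fun i : Fin d => (α i : ℂ)))
    (hα : ∀ i, 1 < α i) (hsum : ∑ i, (α i)⁻¹ ≤ 1 / 2) : |(P.coeff 0 : ℝ)|⁻¹ ≤ 1 / 2 := by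
  refine le_trans ?_ (inv_le_half hα hsum ⟨0, hd⟩)
  rw [abs_coeff_zero hP hroots hα]
  refine inv_anti₀ (one_pos.trans (hα _)) ?_
  rw [← Finset.mul_prod_erase _ _ (Finset.mem_univ (⟨0, hd⟩ : Fin d))]
  exact le_mul_of_one_le_right (one_pos.trans (hα _)).le
    (Finset.prod_induction _ (1 ≤ ·) (fun _ _ => one_le_mul_of_one_le_of_one_le) le_rfl
      fun i _ => (hα i).le)

/-- The spectrum below the limit point: the only candidates are the weighted sums along the
periodic sequences `per k`. -/
theorem exists_eq_of_mem_spectrum (hP : P.Monic) (hd : 1 ≤ d)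
    (hroots : P.aroots ℂ = Finset.univ.val.map (fun i : Fin d => (α i : ℂ)))
    (hsimple : Function.Injective α) (hα : ∀ i, 1 < α i) (hsum : ∑ i, (α i)⁻¹ ≤ 1 / 2)
    {v : ℝ} (hv : v ∈ spectrum P)
    (hlt : v < |(P.coeff 0 : ℝ)|⁻¹ *
      wsum (weight (pfKernel (fun i => (α i)⁻¹) Finset.univ)) thueMorse) :
    ∃ k, v = |(P.coeff 0 : ℝ)|⁻¹ *
      wsum (weight (pfKernel (fun i => (α i)⁻¹) Finset.univ)) (per k) := by
  have hpos : ∀ i, 0 < α i := fun i => one_pos.trans (hα i)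
  have hβ0 : ∀ i, 0 < (α i)⁻¹ := fun i => inv_pos.2 (hpos i)
  have hβ1 : ∀ i, (α i)⁻¹ < 1 := fun i => inv_lt_one_of_one_lt₀ (hα i)
  have hβinj : Function.Injective fun i => (α i)⁻¹ := inv_injective.comp hsimple
  have hne : (Finset.univ : Finset (Fin d)).Nonempty := ⟨⟨0, hd⟩, Finset.mem_univ _⟩
  have hK := isKernel_pfKernel hβ0 hβinj hne hsum
  set K := pfKernel (fun i => (α i)⁻¹) Finset.univ with hKdef
  have ha : 0 < |(P.coeff 0 : ℝ)| := by
    rw [abs_coeff_zero hP hroots hα]; exact Finset.prod_pos fun i _ => hpos i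
  obtain ⟨y, hy, rfl⟩ := (mem_spectrum_iff hd hroots hsimple hα v).1 hv
  have hbdd : ∀ n, |distInt (y n)| ≤ 1 / 2 := fun n => by
    rw [abs_of_nonneg (distInt_nonneg _)]; exact distInt_le_half _
  set ε : ℕ → ℝ := fun n => y n - round (y n) with hε
  have hεabs : ∀ n, |ε n| = distInt (y n) := fun n => rfl
  have hεb : IsBdd ε := ⟨1 / 2, fun n => by rw [hεabs]; exact distInt_le_half _⟩
  set t : ℕ → ℤ := fun n =>
    ∑ j ∈ Finset.range (P.natDegree + 1), P.coeff j * round (y (n + j)) with ht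
  have hsplit : aeval shift (Lagrange.nodal Finset.univ α) ε = -fun n => (t n : ℝ) := by
    have h1 : ε = y - fun n => ((round (y n) : ℤ) : ℝ) := rfl
    rw [h1, map_sub, hy, zero_sub, ← map_eq_nodal hP hroots]
    congr 1
    funext n
    exact aeval_shift_map_intCast P (fun n => round (y n)) n
  have hcorr : ∀ n, |corr K (fun i => (t i : ℝ)) n| = |(P.coeff 0 : ℝ)| * distInt (y n) := by
    intro n
    have h1 := congrFun (corr_pfKernel_aeval_nodal (s := Finset.univ) hβ0 hβ1 hβinj hne hεb) n
    simp only [inv_inv] at h1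
    rw [hsplit, eval_zero_nodal hP hroots, Pi.smul_apply, smul_eq_mul] at h1
    rw [← hεabs, ← abs_mul, ← h1, corr, corr, ← abs_neg, ← tsum_neg]
    congr 1
    exact tsum_congr fun k => by rw [Pi.neg_apply]; ring
  have hlim : limsup (fun n => |corr K (fun i => (t i : ℝ)) n|) atTop =
      |(P.coeff 0 : ℝ)| * limsup (fun n => distInt (y n)) atTop := by
    simp only [hcorr]
    exact limsup_const_mul_of_abs_le ha hbdd
  have hlt' : limsup (fun n => |corr K (fun i => (t i : ℝ)) n|) atTop <
      wsum (weight K) thueMorse := by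
    rw [hlim]; rwa [inv_mul_eq_div, lt_div_iff₀' ha] at hlt
  -- `M` bounds the distances eventually, and `|a_0| M < 1` because digit sums never exceed 1.
  obtain ⟨M, hM1, hM2⟩ := exists_between hlt
  obtain ⟨N, hN⟩ := eventually_atTop.1 (eventually_lt_of_limsup_lt hM1
    (isBoundedUnder_of ⟨1 / 2, fun n => distInt_le_half (y n)⟩))
  have hM3 : |(P.coeff 0 : ℝ)| * M < 1 := by
    rw [inv_mul_eq_div, lt_div_iff₀' ha] at hM2
    exact hM2.trans_le (hK.wsum_le_one _)
  have h1 : ∀ᶠ n in atTop, |t n| ≤ 1 := by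
    filter_upwards [eventually_ge_atTop N] with n hn
    have h1 := abs_aeval_nodal_le (s := Finset.univ) (fun i => (hpos i).le)
      (y := ε) (M := M) (N := N) (fun n hn => (hN n hn).le) n hn
    rw [hsplit, Pi.neg_apply, abs_neg] at h1
    have h2 := prod_one_add_le_two_mul_prod Finset.univ hα hsum
    rw [← abs_coeff_zero hP hroots hα] at h2
    have h3 : 0 ≤ M := (distInt_nonneg _).trans (hN n hn).le
    -- `|t n| ≤ ∏ (1 + α_i) M ≤ 2 |a_0| M < 2`.
    have h4 : |(t n : ℝ)| < 2 := by nlinarith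
    have h5 : |t n| < 2 := by exact_mod_cast h4
    omega
  have h2 : ∀ᶠ n in atTop, |corr K (fun i => (t i : ℝ)) n| < 1 := by
    filter_upwards [eventually_ge_atTop N] with n hn
    rw [hcorr]
    exact (mul_lt_mul_of_pos_left (hN n hn) ha).trans hM3
  obtain ⟨k, hk⟩ := hK.limsup_corr_eq h1 h2 hlt'
  exact ⟨k, by rw [← hk, hlim, inv_mul_cancel_left₀ ha.ne']⟩

theorem mem_spectrum_per (hP : P.Monic) (hd : 1 ≤ d)
    (hroots : P.aroots ℂ = Finset.univ.val.map (fun i : Fin d => (α i : ℂ)))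
    (hsimple : Function.Injective α) (hα : ∀ i, 1 < α i) (hsum : ∑ i, (α i)⁻¹ ≤ 1 / 2) (k : ℕ) :
    |(P.coeff 0 : ℝ)|⁻¹ *
      wsum (weight (pfKernel (fun i => (α i)⁻¹) Finset.univ)) (per k) ∈ spectrum P := by
  have hpos : ∀ i, 0 < α i := fun i => one_pos.trans (hα i)
  have hβ0 : ∀ i, 0 < (α i)⁻¹ := fun i => inv_pos.2 (hpos i)
  have hβ1 : ∀ i, (α i)⁻¹ < 1 := fun i => inv_lt_one_of_one_lt₀ (hα i)
  have hβinj : Function.Injective fun i => (α i)⁻¹ := inv_injective.comp hsimple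
  have hne : (Finset.univ : Finset (Fin d)).Nonempty := ⟨⟨0, hd⟩, Finset.mem_univ _⟩
  have hK := isKernel_pfKernel hβ0 hβinj hne hsum
  set K := pfKernel (fun i => (α i)⁻¹) Finset.univ with hKdef
  have ha : 0 < |(P.coeff 0 : ℝ)| := by
    rw [abs_coeff_zero hP hroots hα]; exact Finset.prod_pos fun i _ => hpos i
  have ha' : (P.coeff 0 : ℝ) ≠ 0 := abs_pos.1 ha
  have hhalf := inv_abs_coeff_zero_le_half hP hd hroots hα hsum
  set t : ℕ → ℤ := fun n => (if per k n then 1 else 0) - (if per k (n + 1) then 1 else 0) with ht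
  have htb : ∀ n, (t n : ℝ) = bit (per k n) - bit (per k (n + 1)) := fun n => by
    rw [ht]; push_cast; rfl
  obtain ⟨hle, hlim⟩ := hK.limsup_corr_per htb
  have htbdd : IsBdd fun n => (t n : ℝ) := ⟨1, fun n => by
    simp only [htb, abs_le]; exact ⟨neg_one_le_bit_sub _ _, bit_sub_le_one _ _⟩⟩
  set ε : ℕ → ℝ := (P.coeff 0 : ℝ)⁻¹ • corr K fun i => (t i : ℝ) with hε
  have hεabs : ∀ n, |ε n| = |(P.coeff 0 : ℝ)|⁻¹ * |corr K (fun i => (t i : ℝ)) n| := fun n => by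
    rw [hε, Pi.smul_apply, smul_eq_mul, abs_mul, abs_inv]
  have hεle : ∀ n, |ε n| ≤ 1 / 2 := fun n => by
    rw [hεabs]
    exact (mul_le_of_le_one_right (inv_pos.2 ha).le (hle n)).trans hhalf
  -- Any integer solution of `P(S) u = -t` serves: it cancels `P(S) ε = t` and leaves distances
  -- unchanged.
  set u : ℕ → ℤ := solveRec P fun n => -t n with hu
  refine (mem_spectrum_iff hd hroots hsimple hα _).2 ⟨fun n => u n + ε n, ?_, ?_⟩
  · have h1 := aeval_nodal_corr_pfKernel (s := Finset.univ) hβ0 hβ1 hβinj hne htbdd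
    simp only [inv_inv] at h1
    have h2 : aeval shift (Lagrange.nodal Finset.univ α) (fun n => (u n : ℝ)) =
        -fun n => (t n : ℝ) := by
      rw [← map_eq_nodal hP hroots]
      funext n
      rw [aeval_shift_map_intCast, sum_coeff_mul_solveRec hP]
      simp
    have h3 : (fun n => (u n : ℝ) + ε n) = (fun n => (u n : ℝ)) + ε := rfl
    rw [h3, map_add, h2, hε, map_smul, h1, eval_zero_nodal hP hroots, inv_smul_smul₀ ha',
      neg_add_cancel]
  · simp only [distInt_intCast_add _ (hεle _), hεabs]
    rw [limsup_const_mul_of_abs_le (inv_pos.2 ha) (C := 1) fun n => by rw [abs_abs]; exact hle n,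
      hlim]

/-- Below any `c < e` the set `S` contains only finitely many of the `w k` and nothing else, so it
cannot accumulate there. -/
theorem isLeast_setOf_accPt {S : Set ℝ} {e : ℝ} {w : ℕ → ℝ} (hw : Tendsto w atTop (𝓝 e))
    (hmem : ∀ k, w k ∈ S) (hne : ∀ k, w k ≠ e) (hS : ∀ v ∈ S, v < e → ∃ k, v = w k) :
    IsLeast {x : ℝ | AccPt x (𝓟 S)} e := by
  constructor
  · exact accPt_iff_frequently.2 (hw.frequently (Frequently.of_forall fun k => ⟨hne k, hmem k⟩))
  · intro x hx
    by_contra hlt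
    obtain ⟨c, hxc, hce⟩ := exists_between (not_le.1 hlt)
    obtain ⟨m, hm⟩ := eventually_atTop.1 (hw.eventually (lt_mem_nhds hce))
    set F : Set ℝ := w '' Set.Iio m \ {x}
    have hF : F.Finite := ((Set.finite_Iio m).image w).sdiff
    have h1 : ∀ᶠ y in 𝓝 x, y ∉ F := hF.isClosed.isOpen_compl.mem_nhds fun h => h.2 rfl
    obtain ⟨y, ⟨hyx, hyS⟩, hyF, hyc⟩ :=
      ((accPt_iff_frequently.1 hx).and_eventually (h1.and (gt_mem_nhds hxc))).exists
    obtain ⟨k, rfl⟩ := hS y hyS (hyc.trans hce)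
    refine hyF ⟨⟨k, ?_, rfl⟩, hyx⟩
    by_contra hk
    exact lt_asymm hyc (hm k (not_lt.1 hk))

end Polynomial

end MarkoffLagrange

theorem corollary4p5 (P : ℤ[X]) (hP : P.Monic) (d : ℕ) (hd : 1 ≤ d) (α : Fin d → ℝ)
    (hroots : P.aroots ℂ = Finset.univ.val.map (fun i : Fin d => (α i : ℂ)))
    (hsimple : Function.Injective α)
    (hα : ∀ i, 1 < α i)
    (hsum : ∑ i, (α i)⁻¹ ≤ 1 / 2) :
    IsLeast {x : ℝ | AccPt x (𝓟 (MarkoffLagrange.spectrum P))}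
      (|(P.coeff 0 : ℝ)|⁻¹ * MarkoffLagrange.Emulti (fun i => (α i)⁻¹)) ∧
    MarkoffLagrange.spectrum P ∩
        Set.Ioo 0 (|(P.coeff 0 : ℝ)|⁻¹ * MarkoffLagrange.Emulti (fun i => (α i)⁻¹)) =
      {x : ℝ | ∃ k : ℕ,
        x = |(P.coeff 0 : ℝ)|⁻¹ * MarkoffLagrange.EmultiFin k (fun i => (α i)⁻¹)} := by
  have hpos : ∀ i, 0 < α i := fun i => one_pos.trans (hα i)
  have hβ0 : ∀ i, 0 < (α i)⁻¹ := fun i => inv_pos.2 (hpos i)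
  have hβ := MarkoffLagrange.inv_le_half hα hsum
  have hq := (MarkoffLagrange.isKernel_pfKernel hβ0 (inv_injective.comp hsimple)
    ⟨⟨0, hd⟩, Finset.mem_univ _⟩ hsum).isWeight
  have ha : 0 < |(P.coeff 0 : ℝ)|⁻¹ := by
    rw [MarkoffLagrange.abs_coeff_zero hP hroots hα]
    exact inv_pos.2 (Finset.prod_pos fun i _ => hpos i)
  have hper := MarkoffLagrange.mem_spectrum_per hP hd hroots hsimple hα hsum
  have hlt := fun k => mul_lt_mul_of_pos_left (hq.wsum_per_lt k) ha
  have hexists : ∀ v ∈ MarkoffLagrange.spectrum P, v < |(P.coeff 0 : ℝ)|⁻¹ * _ → _ := fun v hv =>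
    MarkoffLagrange.exists_eq_of_mem_spectrum hP hd hroots hsimple hα hsum hv
  simp only [MarkoffLagrange.Emulti_eq_wsum hβ0 hβ, MarkoffLagrange.EmultiFin_eq_wsum hβ0 hβ]
  refine ⟨MarkoffLagrange.isLeast_setOf_accPt (hq.tendsto_wsum_per.const_mul _) hper
    (fun k => (hlt k).ne) hexists, Set.ext fun v => ⟨?_, ?_⟩⟩
  · rintro ⟨hv, hv0, hve⟩
    obtain ⟨_ | k, rfl⟩ := hexists v hv hve
    -- `per 0` gives the value 0, which the open interval excludes; this is the shift between `per
    -- (k + 1)` and `EmultiFin k`.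
    · simp [MarkoffLagrange.IsWeight.wsum_per_zero] at hv0
    · exact ⟨k, rfl⟩
  · rintro ⟨k, rfl⟩
    exact ⟨hper (k + 1), mul_pos ha (hq.wsum_per_succ_pos k), hlt (k + 1)⟩
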